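/- Let $q_1,q_2,q_3,q_4$ be the vertices (in cyclic order) of a square in $\mathbb R^2$ and let $q_5$ be its centre. Let $F_1(x)=\frac12x+\frac12q_1$ and $F_i(x)=\frac13x+\frac23q_i$ for $i=2,3,4,5$, and let $\mathcal V^o$ (the Vicsek set with overlaps) be the invariant set of $\{F_i\}_{i=1}^5$, i.e. the nonempty compact set with $\mathcal V^o=\bigcup_iF_i\mathcal V^o$. Put $K_1=\mathcal V^o$, $K_2=\bigcup_{i=1,2,4,5}F_i\mathcal V^o$ and $(\psi_1,\dots,\psi_6)=(\mathrm{id},F_3,F_1,F_2,F_4,F_5)$, so that $$K_1=\psi_1K_2\cup\psi_2K_1,\qquad K_2=\psi_3K_2\cup\psi_4K_1\cup\psi_5K_1\cup\psi_6K_1 .$$ This is a graph-directed construction on a directed graph with two states $1,2$ and six edges $e_1,\dots,e_6$ (the edge $e$ leads from the state $i(e)$ to the state $f(e)$ and carries the map $\psi_e$). The walks $w=e_{k_1}\cdots e_{k_n}$ ($n\ge0$) starting at state $1$ index the islands $K_w=\psi_w(K_{f(w)})$ of a nested structure of $\mathcal V^o$, where $\psi_w=\psi_{k_1}\circ\dots\circ\psi_{k_n}$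 and $f(w)$, the type of the island, is the final state of $w$; the children of $w$ are the walks $we$ with $i(e)=f(w)$, and $C_w$ is the union of the intersections of any two distinct children of $K_w$. The boundary $V_s$ of $K_s$ is the union, over all nonempty walks $w$ from $1$ to $s$, of $\psi_w^{-1}\big(K_w\cap\bigcup_pC_p\big)$, where $p$ runs over the proper initial segments of $w$. A Laplacian on a finite set $V$ is a symmetric non-positive definite operator $H$ on $\ell(V)=\mathbb R^V$ with $H_{xy}\ge0$ for $x\ne y$ whose kernel consists exactly of the constants; its energy is $\mathcal E_H(u)=\frac12\sum_{x,y}H_{xy}(u(x)-u(y))^2$. For $V\subset U$, an energy $\mathcal E_1$ on $\ell(V)$ is called the trace of an energy $\mathcal E_2$ on $\ell(U)$ if $\mathcal E_1(v)=\min\{\mathcal E_2(u):u|_V=v\}$ for all $v\in\ell(V)$. For Laplacians $D_s$ on $V_s$ ($s=1,2$) and $r=(r_1,\dots,r_6)\in(0,\infty)^6$ put $\mathcal E_{s,0}=\mathcal E_{D_s}$ and $\mathcal E_{s,n+1}(u)=\sum_{i(e)=s}r_e^{-1}\mathcal E_{f(e),n}(u\circ\psi_e)$. The pair $(\{D_1,D_2\},r)$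 is a harmonic structure if $\mathcal E_{s,0}$ is the trace of $\mathcal E_{s,1}$ for $s=1,2$; then $\mathcal E_{s,n}(u)$ is non-decreasing in $n$, and $\mathcal E_s(u)=\lim_n\mathcal E_{s,n}(u)\in[0,\infty]$. Write $r_w=r_{k_1}\cdots r_{k_n}$ for a walk $w$. The harmonic structure is regular if $r_w<1$ for every cycle $w$ of the graph. It is symmetric if $\mathcal E_1$ and $\mathcal E_2$ are invariant under $u\mapsto u\circ R$, where $R$ is the reflection in the diagonal through $q_1$ and $q_3$. It is homogeneous if $r_w=r_{w'}$ whenever $w,w'$ are walks from state $1$ such that $K_w$, $K_{w'}$ have the same type and the same diameter. Then the following hold. (1) $V_1=\{q_1,q_2,q_3,q_4\}$ and $V_2=\{q_1,q_2,F_3q_1,q_4\}$. (2) For $t_1,t_2>0$, replacing $D_s$ by $t_sD_s$ and $r_e$ by $\frac{t_{f(e)}}{t_{i(e)}}r_e$ changes none of the properties of being a regular harmonic structure, symmetric, homogeneous. For every regular harmonic structure there is exactly one choice of $t_1,t_2>0$ for which the result is normalized in the following sense: for each $s$, $\mathcal E_{D_s}$ is the trace of the energy of a star-shaped network, in which each point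 of $V_s$ is joined to $q_5$ by a positive resistance, with resistance $1$ between $q_1$ and $q_5$. (3) The normalized regular harmonic structures are in one-to-one correspondence with the $4$ parameters $a,b,c,d>0$, $b>d$: the resistances between $q_5$ and $q_1,q_2,q_3,q_4$ in the first star are $1,a,b,c$, those between $q_5$ and $q_1,q_2,F_3q_1,q_4$ in the second star are $1,a,d,c$, and $$r_1=1,\quad r_2=\frac{b-d}{1+b},\quad r_3=\frac{b-d}{b+bd},\quad r_4=\frac{ab-ad}{ab+cb},\quad r_5=\frac{cb-cd}{ab+cb},\quad r_6=\frac db .$$ (4) The symmetric ones among them are exactly those with $a=c$, and so correspond to the $3$ parameters $a,b,d>0$, $b>d$. (5) The homogeneous ones among them are exactly those with $b=1$, $d=\frac13$, $a=c$, and so correspond to the $1$ parameter $a>0$. -/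

import Mathlib

open Set Filter
open scoped ENNReal

noncomputable section

namespace Vicsek

/-! ### Discrete Laplacians and energies on a finite set -/

section Networks

variable {X : Type*}

open Classical in
/-- The matrix entry `H_{xy}` of a linear operator on `l(V)`. -/
def entry {V : Set X} (H : (V → ℝ) →ₗ[ℝ] (V → ℝ)) (x y : V) : ℝ :=
  H (Pi.single y 1) x

/-- `H` is a (discrete) Laplacian on the finite set `V`. -/
structure IsLaplacian {V : Set X} (H : (V → ℝ) →ₗ[ℝ] (V → ℝ)) : Prop where
  finite : V.Finite
  symm : ∀ x y, entry H x y = entry H y x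
  nonpos : ∀ u : V → ℝ, ∑ᶠ x, u x * H u x ≤ 0
  ker : ∀ u : V → ℝ, H u = 0 ↔ ∃ c : ℝ, u = fun _ => c
  offdiag : ∀ x y, x ≠ y → 0 ≤ entry H x y

/-- The Dirichlet form `E_H(u) = ∑_{x ~ y} H_{xy} (u(x) - u(y))²`, the sum being over unordered
pairs (whence the factor `1/2`). -/
def dirichletEnergy {V : Set X} (H : (V → ℝ) →ₗ[ℝ] (V → ℝ)) (u : V → ℝ) : ℝ :=
  (1 / 2) * ∑ᶠ x, ∑ᶠ y, entry H x y * (u x - u y) ^ 2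

/-- Compatibility of energies. Functions on a finite subset of `X` are written as restrictions
of functions on `X`; `E₁` only looks at the values on `V`, and `E₂` only at the values on a larger
finite set `U`. Then this is `E₁(v) = min {E₂(u) : u ∈ l(U), u|_V = v}` for every `v ∈ l(V)`. -/
def IsTrace (V : Set X) (E₁ E₂ : (X → ℝ) → ℝ) : Prop :=
  ∀ v : X → ℝ, IsLeast {t | ∃ u : X → ℝ, EqOn u v V ∧ E₂ u = t} (E₁ v)

/-- The energy of the star-shaped resistance network in which, for each `k`, the point `z k` is
joined to the centre `o` by a resistor `ρ k`. -/
def starEnergy (z : Fin 4 → X) (o : X) (ρ : Fin 4 → ℝ) (u : X → ℝ) : ℝ :=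
  ∑ k, (u (z k) - u o) ^ 2 / ρ k

end Networks

/-! ### Graph-directed families and the nested structure of walks -/

/-- A directed graph with states `S` and edges `E`, a map `ψ e` for each edge, a compact set
`K s` for each state, and a root state. -/
structure GraphDirected (X S E : Type*) where
  init : E → S
  fin : E → S
  ψ : E → X → X
  K : S → Set X
  root : S

namespace GraphDirected

variable {X S E : Type*} (G : GraphDirected X S E)

/-- `w` is a walk emanating from `s`. -/
def IsWalk : S → List E → Prop
  | _, [] => True
  | s, e :: w => G.init e = s ∧ IsWalk (G.fin e) w

/-- The final state of a walk emanating from `s`. -/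
def endpoint : S → List E → S
  | s, [] => s
  | _, e :: w => endpoint (G.fin e) w

/-- `ψ_w = ψ_{e₁} ∘ ⋯ ∘ ψ_{eₙ}`. -/
def map : List E → X → X
  | [] => id
  | e :: w => G.ψ e ∘ map w

/-- The island with index `w`, a walk emanating from the root: `K_w = ψ_w(K_{f(w)})`. -/
def island (w : List E) : Set X := G.map w '' G.K (G.endpoint G.root w)

/-- `C_w`, the union of the intersections of two distinct children of the island `w`; the children
of `w` are the walks `w e` with `i(e) = f(w)`. -/
def critical (w : List E) : Set X :=
  {x | ∃ e e' : E, e ≠ e' ∧ G.init e = G.endpoint G.root w ∧ G.init e' = G.endpoint G.root w ∧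
    x ∈ G.island (w ++ [e]) ∩ G.island (w ++ [e'])}

/-- The boundary `V_s` of the island `K s`: the union, over the islands `w` of type `s` other than
the root, of the preimages under `ψ_w : K_s → K_w` of the points of `K_w` that lie in `C_p` for
some proper ancestor `p` of `w`, that is, a proper initial segment of the walk. -/
def boundary (s : S) : Set X :=
  {x | ∃ w : List E, w ≠ [] ∧ G.IsWalk G.root w ∧ G.endpoint G.root w = s ∧
    G.map w x ∈ G.island w ∧ ∃ p q : List E, w = p ++ q ∧ q ≠ [] ∧ G.map w x ∈ G.critical p}

/-- A pair `({D_s}, r)`: an operator on `l(V_s)` for each type, and a number for each edge. -/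
@[ext] structure Pair where
  D : ∀ s, (G.boundary s → ℝ) →ₗ[ℝ] (G.boundary s → ℝ)
  r : E → ℝ

namespace Pair

variable {G}

/-- `r_w = r_{e₁} ⋯ r_{eₙ}`. -/
def weight (h : G.Pair) (w : List E) : ℝ := (w.map h.r).prod

/-- The pair obtained by multiplying `D_s` by `c s`, with `r` changed accordingly. -/
def rescale (h : G.Pair) (c : S → ℝ) : G.Pair where
  D s := c s • h.D s
  r e := c (G.fin e) / c (G.init e) * h.r e

/-- Homogeneity: islands of the same type and the same size have the same factor. -/
def IsHomogeneous [PseudoMetricSpace X] (h : G.Pair) : Prop :=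
  ∀ w w' : List E, G.IsWalk G.root w → G.IsWalk G.root w' →
    G.endpoint G.root w = G.endpoint G.root w' →
    Metric.diam (G.island w) = Metric.diam (G.island w') → h.weight w = h.weight w'

variable [Fintype E] [DecidableEq S]

/-- The forms `E_{s,n}` on `l(V_{s,n})`, applied to restrictions of functions on `X`:
`E_{s,0} = E_{D_s}` and `E_{s,n+1}(u) = ∑_{i(e) = s} r_e⁻¹ E_{f(e),n}(u ∘ ψ_e)`. -/
def level (h : G.Pair) : ℕ → S → (X → ℝ) → ℝ
  | 0, s, u => dirichletEnergy (h.D s) (fun x => u x)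
  | n + 1, s, u => ∑ e with G.init e = s, (h.r e)⁻¹ * level h n (G.fin e) (u ∘ G.ψ e)

/-- The limit form `E_s(u) = lim_n E_{s,n}(u) ∈ [0, ∞]` (for a harmonic structure the sequence is
non-decreasing in `n`, so that the limit is the supremum); its domain is `{E_s < ∞}`. -/
def energy (h : G.Pair) (s : S) (u : X → ℝ) : ℝ≥0∞ :=
  ⨆ n, ENNReal.ofReal (h.level n s u)

/-- Harmonic structures: Laplacians and positive factors that satisfy the renormalization
equations. -/
structure IsHarmonicStructure (h : G.Pair) : Prop where
  laplacian : ∀ s, IsLaplacian (h.D s)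
  pos : ∀ e, 0 < h.r e
  renormalization : ∀ s, IsTrace (G.boundary s) (h.level 0 s) (h.level 1 s)

/-- Regular harmonic structures: `r_w < 1` for every cycle `w` of the graph. -/
structure IsRegular (h : G.Pair) : Prop extends h.IsHarmonicStructure where
  cycle_lt_one : ∀ (s : S) (w : List E), w ≠ [] → G.IsWalk s w → G.endpoint s w = s →
    h.weight w < 1

/-- The limit forms on the islands of all types are invariant under `g`. -/
def IsInvariantUnder (h : G.Pair) (g : X → X) : Prop :=
  ∀ (s : S) (u : X → ℝ), h.energy s (u ∘ g) = h.energy s u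

end Pair

end GraphDirected

/-! ### The Vicsek set with overlaps -/

/-- The Euclidean plane. -/
abbrev Plane : Type := EuclideanSpace ℝ (Fin 2)

/-- `q 0, q 1, q 2, q 3` are the vertices, in cyclic order, of a (nondegenerate) square. -/
structure IsSquare (q : Fin 4 → Plane) : Prop where
  ne : q 1 ≠ q 0
  norm_eq : ‖q 1 - q 0‖ = ‖q 3 - q 0‖
  orthogonal : inner ℝ (q 1 - q 0) (q 3 - q 0) = 0
  fourth : q 2 - q 0 = (q 1 - q 0) + (q 3 - q 0)

/-- The centre of the square. -/
def center (q : Fin 4 → Plane) : Plane := midpoint ℝ (q 0) (q 2)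

/-- The five maps: ratio `1/2` at the first vertex, ratio `1/3` at the other three vertices and at
the centre. -/
def F (q : Fin 4 → Plane) : Fin 5 → Plane → Plane :=
  ![fun x => (1 / 2 : ℝ) • x + (1 / 2 : ℝ) • q 0,
    fun x => (1 / 3 : ℝ) • x + (2 / 3 : ℝ) • q 1,
    fun x => (1 / 3 : ℝ) • x + (2 / 3 : ℝ) • q 2,
    fun x => (1 / 3 : ℝ) • x + (2 / 3 : ℝ) • q 3,
    fun x => (1 / 3 : ℝ) • x + (2 / 3 : ℝ) • center q]

/-- `A` is the invariant set of the five maps, the Vicsek set with overlaps. -/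
structure IsVicsekSet (q : Fin 4 → Plane) (A : Set Plane) : Prop where
  nonempty : A.Nonempty
  compact : IsCompact A
  invariant : A = ⋃ i, F q i '' A

/-- The graph-directed construction
`K₁ = ψ₁ K₂ ∪ ψ₂ K₁`, `K₂ = ψ₃ K₂ ∪ ψ₄ K₁ ∪ ψ₅ K₁ ∪ ψ₆ K₁`, where `K₁` is the Vicsek set,
`K₂ = F₁ K₁ ∪ F₂ K₁ ∪ F₄ K₁ ∪ F₅ K₁` and `(ψ₁, …, ψ₆) = (id, F₃, F₁, F₂, F₄, F₅)`.
All indices are shifted by one. -/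
def graph (q : Fin 4 → Plane) (A : Set Plane) : GraphDirected Plane (Fin 2) (Fin 6) where
  init := ![0, 0, 1, 1, 1, 1]
  fin := ![1, 0, 1, 0, 0, 0]
  ψ := ![id, F q 2, F q 0, F q 1, F q 3, F q 4]
  K := ![A, F q 0 '' A ∪ F q 1 '' A ∪ F q 3 '' A ∪ F q 4 '' A]
  root := 0

/-- The tips of the two star-shaped networks: `q₁, q₂, q₃, q₄` and `q₁, q₂, F₃ q₁, q₄`. -/
def tips (q : Fin 4 → Plane) : Fin 2 → Fin 4 → Plane :=
  ![![q 0, q 1, q 2, q 3], ![q 0, q 1, F q 2 (q 0), q 3]]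

/-- The reflection of the plane in the diagonal through the first and the third vertex. -/
def diagonalReflection (q : Fin 4 → Plane) : Plane → Plane :=
  EuclideanGeometry.reflection (AffineSubspace.mk' (q 0) (Submodule.span ℝ {q 2 - q 0}))

section Solutions

variable {q : Fin 4 → Plane} {A : Set Plane}

/-- `(V_s, D_s)` is the trace of the star-shaped network with resistances `ρ` between the tips and
the centre of the square. -/
def IsStarTrace (h : (graph q A).Pair) (s : Fin 2) (ρ : Fin 4 → ℝ) : Prop :=
  IsTrace ((graph q A).boundary s) (h.level 0 s) (starEnergy (tips q s) (center q) ρ)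

/-- The normalization: in both star-shaped networks the resistance between the first vertex and
the centre of the square is `1`. -/
def IsNormalized (h : (graph q A).Pair) : Prop :=
  ∀ s, ∃ ρ : Fin 4 → ℝ, (∀ k, 0 < ρ k) ∧ ρ 0 = 1 ∧ IsStarTrace h s ρ

/-- `h` is the solution with parameters `a, b, c, d`: the resistances are `1, a, b, c` and
`1, a, d, c`, and `r₁, …, r₆` are given by the explicit formulas. -/
structure IsSolution (a b c d : ℝ) (h : (graph q A).Pair) : Prop where
  star_one : IsStarTrace h 0 ![1, a, b, c]
  star_two : IsStarTrace h 1 ![1, a, d, c]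
  factors : h.r = ![1, (b - d) / (1 + b), (b - d) / (b + b * d),
    (a * b - a * d) / (a * b + c * b), (c * b - c * d) / (a * b + c * b), d / b]

end Solutions

/-- `R` is a one-to-one correspondence between the parameters in `P` and the elements of `H`. -/
def Parametrizes {α β : Type*} (P : Set α) (H : Set β) (R : α → β → Prop) : Prop :=
  (∀ p ∈ P, ∃! h, h ∈ H ∧ R p h) ∧ ∀ h ∈ H, ∃! p, p ∈ P ∧ R p h

end Vicsek

end

namespace Vicsek

/-! ### Coordinates adapted to the square -/

/-- The coordinate in the direction of `q 1 - q 0`, in units of the side of the square. -/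
noncomputable def xCoord (q : Fin 4 → Plane) (x : Plane) : ℝ :=
  inner ℝ (q 1 - q 0) (x - q 0) / ‖q 1 - q 0‖ ^ 2

/-- The coordinate in the direction of `q 3 - q 0`, in units of the side of the square. -/
noncomputable def yCoord (q : Fin 4 → Plane) (x : Plane) : ℝ :=
  inner ℝ (q 3 - q 0) (x - q 0) / ‖q 1 - q 0‖ ^ 2

variable {q : Fin 4 → Plane} {A : Set Plane}

theorem xCoord_combo (q : Fin 4 → Plane) (s t : ℝ) (hst : s + t = 1) (x y : Plane) :
    xCoord q (s • x + t • y) = s * xCoord q x + t * xCoord q y := by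
  have h : s • x + t • y - q 0 = s • (x - q 0) + t • (y - q 0) := by
    obtain rfl : t = 1 - s := by linarith
    module
  simp only [xCoord, h, inner_add_right, inner_smul_right]
  ring

theorem yCoord_combo (q : Fin 4 → Plane) (s t : ℝ) (hst : s + t = 1) (x y : Plane) :
    yCoord q (s • x + t • y) = s * yCoord q x + t * yCoord q y := by
  have h : s • x + t • y - q 0 = s • (x - q 0) + t • (y - q 0) := by
    obtain rfl : t = 1 - s := by linarith
    module
  simp only [yCoord, h, inner_add_right, inner_smul_right]
  ring

theorem continuous_xCoord (q : Fin 4 → Plane) : Continuous (xCoord q) := by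
  unfold xCoord; fun_prop

theorem continuous_yCoord (q : Fin 4 → Plane) : Continuous (yCoord q) := by
  unfold yCoord; fun_prop

namespace IsSquare

theorem normSq_pos (hq : IsSquare q) : 0 < ‖q 1 - q 0‖ ^ 2 := by
  have := sub_ne_zero.2 hq.ne
  positivity

theorem xCoord_zero : xCoord q (q 0) = 0 := by simp [xCoord]

theorem yCoord_zero : yCoord q (q 0) = 0 := by simp [yCoord]

theorem xCoord_one (hq : IsSquare q) : xCoord q (q 1) = 1 := by
  rw [xCoord, real_inner_self_eq_norm_sq]; exact div_self hq.normSq_pos.ne'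

theorem yCoord_one (hq : IsSquare q) : yCoord q (q 1) = 0 := by
  rw [yCoord, real_inner_comm, hq.orthogonal, zero_div]

theorem xCoord_three (hq : IsSquare q) : xCoord q (q 3) = 0 := by
  rw [xCoord, hq.orthogonal, zero_div]

theorem yCoord_three (hq : IsSquare q) : yCoord q (q 3) = 1 := by
  rw [yCoord, real_inner_self_eq_norm_sq, ← hq.norm_eq]; exact div_self hq.normSq_pos.ne'

theorem xCoord_two (hq : IsSquare q) : xCoord q (q 2) = 1 := by
  have h1 := hq.xCoord_one
  have h3 := hq.xCoord_three
  rw [xCoord] at *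
  rw [hq.fourth, inner_add_right, add_div, h1, h3, add_zero]

theorem yCoord_two (hq : IsSquare q) : yCoord q (q 2) = 1 := by
  have h1 := hq.yCoord_one
  have h3 := hq.yCoord_three
  rw [yCoord] at *
  rw [hq.fourth, inner_add_right, add_div, h1, h3, zero_add]

theorem center_eq (q : Fin 4 → Plane) :
    center q = (1 / 2 : ℝ) • q 0 + (1 / 2 : ℝ) • q 2 := by
  rw [center, midpoint_eq_smul_add, smul_add]; norm_num

theorem xCoord_center (hq : IsSquare q) : xCoord q (center q) = 1 / 2 := by
  rw [center_eq, xCoord_combo q _ _ (by norm_num), xCoord_zero, hq.xCoord_two]; norm_num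

theorem yCoord_center (hq : IsSquare q) : yCoord q (center q) = 1 / 2 := by
  rw [center_eq, yCoord_combo q _ _ (by norm_num), yCoord_zero, hq.yCoord_two]; norm_num

/-- The two coordinates separate points. -/
theorem ext_coord (hq : IsSquare q) {x y : Plane} (hx : xCoord q x = xCoord q y)
    (hy : yCoord q x = yCoord q y) : x = y := by
  have hp := hq.normSq_pos
  have ho := hq.orthogonal
  have hn : ‖q 1 - q 0‖ ^ 2 = ‖q 3 - q 0‖ ^ 2 := by rw [hq.norm_eq]
  rw [xCoord, xCoord, div_left_inj' hp.ne', ← sub_eq_zero, ← inner_sub_right,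
    sub_sub_sub_cancel_right] at hx
  rw [yCoord, yCoord, div_left_inj' hp.ne', ← sub_eq_zero, ← inner_sub_right,
    sub_sub_sub_cancel_right] at hy
  rw [← sub_eq_zero]
  generalize x - y = v at *
  generalize q 1 - q 0 = a at *
  generalize q 3 - q 0 = b at *
  rw [EuclideanSpace.real_norm_sq_eq] at hp hn
  rw [EuclideanSpace.real_norm_sq_eq] at hn
  simp only [PiLp.inner_apply, Fin.sum_univ_two, RCLike.inner_apply, conj_trivial] at *
  have hD : a 0 * b 1 - a 1 * b 0 ≠ 0 := by
    intro h
    have : (a 0 ^ 2 + a 1 ^ 2) ^ 2 = 0 := by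
      calc (a 0 ^ 2 + a 1 ^ 2) ^ 2 = (a 0 ^ 2 + a 1 ^ 2) * (b 0 ^ 2 + b 1 ^ 2) := by
            rw [← hn]; ring
        _ = (b 0 * a 0 + b 1 * a 1) ^ 2 + (a 0 * b 1 - a 1 * b 0) ^ 2 := by ring
        _ = 0 := by rw [ho, h]; ring
    exact hp.ne' (pow_eq_zero_iff (two_ne_zero) |>.1 this)
  ext k
  fin_cases k
  · refine (mul_eq_zero.1 (?_ : (a 0 * b 1 - a 1 * b 0) * v 0 = 0)).resolve_left hD
    linear_combination b 1 * hx - a 1 * hy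
  · refine (mul_eq_zero.1 (?_ : (a 0 * b 1 - a 1 * b 0) * v 1 = 0)).resolve_left hD
    linear_combination a 0 * hy - b 0 * hx

end IsSquare

open Vicsek.IsSquare

theorem F_zero (q : Fin 4 → Plane) (x : Plane) :
    F q 0 x = (1 / 2 : ℝ) • x + (1 / 2 : ℝ) • q 0 := rfl

theorem F_one (q : Fin 4 → Plane) (x : Plane) :
    F q 1 x = (1 / 3 : ℝ) • x + (2 / 3 : ℝ) • q 1 := rfl

theorem F_two (q : Fin 4 → Plane) (x : Plane) :
    F q 2 x = (1 / 3 : ℝ) • x + (2 / 3 : ℝ) • q 2 := rfl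

theorem F_three (q : Fin 4 → Plane) (x : Plane) :
    F q 3 x = (1 / 3 : ℝ) • x + (2 / 3 : ℝ) • q 3 := rfl

theorem F_four (q : Fin 4 → Plane) (x : Plane) :
    F q 4 x = (1 / 3 : ℝ) • x + (2 / 3 : ℝ) • center q := rfl

/-- The first coordinates of the images of the five maps. -/
theorem IsSquare.xCoord_F (hq : IsSquare q) (x : Plane) :
    xCoord q (F q 0 x) = xCoord q x / 2 ∧ xCoord q (F q 1 x) = xCoord q x / 3 + 2 / 3 ∧
    xCoord q (F q 2 x) = xCoord q x / 3 + 2 / 3 ∧ xCoord q (F q 3 x) = xCoord q x / 3 ∧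
    xCoord q (F q 4 x) = xCoord q x / 3 + 1 / 3 := by
  refine ⟨?_, ?_, ?_, ?_, ?_⟩ <;>
    simp only [F_zero, F_one, F_two, F_three, F_four] <;>
    rw [xCoord_combo q _ _ (by norm_num)]
  · rw [xCoord_zero]; ring
  · rw [hq.xCoord_one]; ring
  · rw [hq.xCoord_two]; ring
  · rw [hq.xCoord_three]; ring
  · rw [hq.xCoord_center]; ring

/-- The second coordinates of the images of the five maps. -/
theorem IsSquare.yCoord_F (hq : IsSquare q) (x : Plane) :
    yCoord q (F q 0 x) = yCoord q x / 2 ∧ yCoord q (F q 1 x) = yCoord q x / 3 ∧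
    yCoord q (F q 2 x) = yCoord q x / 3 + 2 / 3 ∧ yCoord q (F q 3 x) = yCoord q x / 3 + 2 / 3 ∧
    yCoord q (F q 4 x) = yCoord q x / 3 + 1 / 3 := by
  refine ⟨?_, ?_, ?_, ?_, ?_⟩ <;>
    simp only [F_zero, F_one, F_two, F_three, F_four] <;>
    rw [yCoord_combo q _ _ (by norm_num)]
  · rw [yCoord_zero]; ring
  · rw [hq.yCoord_one]; ring
  · rw [hq.yCoord_two]; ring
  · rw [hq.yCoord_three]; ring
  · rw [hq.yCoord_center]; ring

/-! ### The Vicsek set lies in the square and contains its vertices -/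

theorem IsVicsekSet.le_of_contracting (hA : IsVicsekSet q A) {f : Plane → ℝ} (hf : Continuous f)
    {c : ℝ} (h : ∀ i, ∃ s : ℝ, s < 1 ∧ 0 ≤ s ∧ ∀ x, f (F q i x) ≤ s * f x + (1 - s) * c)
    {x : Plane} (hx : x ∈ A) : f x ≤ c := by
  obtain ⟨m, hm, hmax⟩ := hA.compact.exists_isMaxOn hA.nonempty hf.continuousOn
  refine (hmax hx).trans ?_
  have hm' := hm
  rw [hA.invariant, mem_iUnion] at hm'
  obtain ⟨i, a, ha, rfl⟩ := hm'
  obtain ⟨s, hs, hs0, hF⟩ := h i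
  have h1 := hF a
  have h2 : f a ≤ f (F q i a) := hmax ha
  nlinarith

theorem IsVicsekSet.mem_unit_square (hq : IsSquare q) (hA : IsVicsekSet q A) {x : Plane}
    (hx : x ∈ A) : 0 ≤ xCoord q x ∧ xCoord q x ≤ 1 ∧ 0 ≤ yCoord q x ∧ yCoord q x ≤ 1 := by
  have hs : ∀ i : Fin 5, ∃ s : ℝ, s < 1 ∧ 0 ≤ s ∧ ∀ x,
      (-xCoord q (F q i x) ≤ s * -xCoord q x + (1 - s) * 0 ∧
        xCoord q (F q i x) ≤ s * xCoord q x + (1 - s) * 1) ∧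
      (-yCoord q (F q i x) ≤ s * -yCoord q x + (1 - s) * 0 ∧
        yCoord q (F q i x) ≤ s * yCoord q x + (1 - s) * 1) := by
    intro i
    refine ⟨if i = 0 then 1 / 2 else 1 / 3, by split_ifs <;> norm_num,
      by split_ifs <;> norm_num, fun x => ?_⟩
    obtain ⟨h0, h1, h2, h3, h4⟩ := hq.xCoord_F x
    obtain ⟨k0, k1, k2, k3, k4⟩ := hq.yCoord_F x
    fin_cases i
    · simp [h0, k0]; norm_num; refine ⟨⟨?_, ?_⟩, ?_, ?_⟩ <;> linarith
    · simp [h1, k1]; norm_num; refine ⟨⟨?_, ?_⟩, ?_, ?_⟩ <;> linarith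
    · simp [h2, k2]; norm_num; refine ⟨⟨?_, ?_⟩, ?_, ?_⟩ <;> linarith
    · simp [h3, k3]; norm_num; refine ⟨⟨?_, ?_⟩, ?_, ?_⟩ <;> linarith
    · simp [h4, k4]; norm_num; refine ⟨⟨?_, ?_⟩, ?_, ?_⟩ <;> linarith
  choose s hs1 hs0 hs using hs
  have e1 := hA.le_of_contracting (continuous_xCoord q).neg
    (fun i => ⟨s i, hs1 i, hs0 i, fun x => (hs i x).1.1⟩) hx
  have e2 := hA.le_of_contracting (continuous_xCoord q)
    (fun i => ⟨s i, hs1 i, hs0 i, fun x => (hs i x).1.2⟩) hx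
  have e3 := hA.le_of_contracting (continuous_yCoord q).neg
    (fun i => ⟨s i, hs1 i, hs0 i, fun x => (hs i x).2.1⟩) hx
  have e4 := hA.le_of_contracting (continuous_yCoord q)
    (fun i => ⟨s i, hs1 i, hs0 i, fun x => (hs i x).2.2⟩) hx
  exact ⟨neg_nonpos.1 e1, e2, neg_nonpos.1 e3, e4⟩

theorem IsVicsekSet.image_subset (hA : IsVicsekSet q A) (i : Fin 5) : F q i '' A ⊆ A := by
  intro x hx
  rw [hA.invariant, mem_iUnion]
  exact ⟨i, hx⟩

theorem IsVicsekSet.F_mem (hA : IsVicsekSet q A) (i : Fin 5) {x : Plane} (hx : x ∈ A) :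
    F q i x ∈ A := hA.image_subset i (mem_image_of_mem _ hx)

/-- The fixed point of each of the maps belongs to the invariant set. -/
theorem IsVicsekSet.mem_of_fixed (hA : IsVicsekSet q A) (i : Fin 5) {p : Plane} {s : ℝ}
    (hs0 : 0 ≤ s) (hs : s < 1) (h : ∀ x, F q i x = s • x + (1 - s) • p) : p ∈ A := by
  obtain ⟨m, hm, hmin⟩ := hA.compact.exists_isMinOn hA.nonempty
    (f := fun x => dist x p) (by fun_prop)
  have h1 : dist m p ≤ dist (F q i m) p := hmin (hA.F_mem i hm)
  have h2 : dist (F q i m) p = s * dist m p := by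
    rw [h, dist_eq_norm, dist_eq_norm,
      show s • m + (1 - s) • p - p = s • (m - p) by module, norm_smul, Real.norm_of_nonneg hs0]
  have h3 : dist m p = 0 := by nlinarith [dist_nonneg (x := m) (y := p)]
  rwa [← dist_eq_zero.1 h3]

theorem IsVicsekSet.vertex_mem (hA : IsVicsekSet q A) (k : Fin 4) : q k ∈ A := by
  fin_cases k
  · exact hA.mem_of_fixed 0 (s := 1 / 2) (by norm_num) (by norm_num)
      (fun x => by rw [F_zero]; norm_num)
  · exact hA.mem_of_fixed 1 (s := 1 / 3) (by norm_num) (by norm_num)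
      (fun x => by rw [F_one]; norm_num)
  · exact hA.mem_of_fixed 2 (s := 1 / 3) (by norm_num) (by norm_num)
      (fun x => by rw [F_two]; norm_num; rfl)
  · exact hA.mem_of_fixed 3 (s := 1 / 3) (by norm_num) (by norm_num)
      (fun x => by rw [F_three]; norm_num; rfl)

end Vicsek

namespace Vicsek

open Vicsek.IsSquare

variable {q : Fin 4 → Plane} {A : Set Plane}

/-! ### Intersections of cells -/

/-- Where the second type of island lies. -/
theorem IsVicsekSet.coord_of_mem_K_one (hq : IsSquare q) (hA : IsVicsekSet q A) {x : Plane}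
    (hx : x ∈ (graph q A).K 1) :
    (0 ≤ xCoord q x ∧ xCoord q x ≤ 1 ∧ 0 ≤ yCoord q x ∧ yCoord q x ≤ 1) ∧
    ((xCoord q x ≤ 1 / 2 ∧ yCoord q x ≤ 1 / 2) ∨ yCoord q x ≤ 1 / 3 ∨ xCoord q x ≤ 1 / 3 ∨
      (xCoord q x ≤ 2 / 3 ∧ yCoord q x ≤ 2 / 3)) := by
  rcases hx with ((⟨a, ha, rfl⟩ | ⟨a, ha, rfl⟩) | ⟨a, ha, rfl⟩) | ⟨a, ha, rfl⟩
  all_goals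
    obtain ⟨h0, h1, h2, h3⟩ := hA.mem_unit_square hq ha
    obtain ⟨k0, k1, k2, k3, k4⟩ := hq.xCoord_F a
    obtain ⟨l0, l1, l2, l3, l4⟩ := hq.yCoord_F a
  · rw [k0, l0]
    exact ⟨⟨by linarith, by linarith, by linarith, by linarith⟩, .inl ⟨by linarith, by linarith⟩⟩
  · rw [k1, l1]
    exact ⟨⟨by linarith, by linarith, by linarith, by linarith⟩, .inr (.inl (by linarith))⟩
  · rw [k3, l3]
    exact ⟨⟨by linarith, by linarith, by linarith, by linarith⟩, .inr (.inr (.inl (by linarith)))⟩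
  · rw [k4, l4]
    exact ⟨⟨by linarith, by linarith, by linarith, by linarith⟩,
      .inr (.inr (.inr ⟨by linarith, by linarith⟩))⟩

theorem IsVicsekSet.K_one_subset (hA : IsVicsekSet q A) : (graph q A).K 1 ⊆ A := by
  rintro x (((hx | hx) | hx) | hx) <;> exact hA.image_subset _ hx

/-- The only coincidences between different cells of the same island. -/
theorem IsVicsekSet.coincidence (hq : IsSquare q) (hA : IsVicsekSet q A) {e e' : Fin 6}
    (he : e < e') (hi : (graph q A).init e = (graph q A).init e') {z z' : Plane}
    (hz : z ∈ (graph q A).K ((graph q A).fin e)) (hz' : z' ∈ (graph q A).K ((graph q A).fin e'))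
    (h : (graph q A).ψ e z = (graph q A).ψ e' z') :
    (e = 0 ∧ e' = 1 ∧ z = F q 2 (q 0) ∧ z' = q 0) ∨
    (e = 2 ∧ e' = 5 ∧ z = F q 2 (q 0) ∧ z' = q 0) ∨
    (e = 3 ∧ e' = 5 ∧ z = q 3 ∧ z' = q 1) ∨ (e = 4 ∧ e' = 5 ∧ z = q 1 ∧ z' = q 3) := by
  have hx := congrArg (xCoord q) h
  have hy := congrArg (yCoord q) h
  obtain ⟨k0, k1, k2, k3, k4⟩ := hq.xCoord_F z
  obtain ⟨l0, l1, l2, l3, l4⟩ := hq.yCoord_F z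
  obtain ⟨k0', k1', k2', k3', k4'⟩ := hq.xCoord_F z'
  obtain ⟨l0', l1', l2', l3', l4'⟩ := hq.yCoord_F z'
  have hc : xCoord q (F q 2 (q 0)) = 2 / 3 ∧ yCoord q (F q 2 (q 0)) = 2 / 3 := by
    rw [(hq.xCoord_F _).2.2.1, (hq.yCoord_F _).2.2.1, xCoord_zero, yCoord_zero]; norm_num
  fin_cases e <;> fin_cases e'
  all_goals first
    | exact absurd he (by decide)
    | (exfalso; revert hi; simp [graph]; done)
    | skip
  · change z ∈ (graph q A).K 1 at hz
    change z' ∈ A at hz'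
    change xCoord q z = xCoord q (F q 2 z') at hx
    change yCoord q z = yCoord q (F q 2 z') at hy
    obtain ⟨⟨m0, m1, m2, m3⟩, m⟩ := hA.coord_of_mem_K_one hq hz
    obtain ⟨n0, n1, n2, n3⟩ := hA.mem_unit_square hq hz'
    obtain ⟨p1, p2⟩ : xCoord q z ≤ 2 / 3 ∧ yCoord q z ≤ 2 / 3 := by
      rcases m with m | m | m | m
      · constructor <;> linarith
      · constructor <;> linarith
      · constructor <;> linarith
      · exact m
    refine .inl ⟨rfl, rfl, hq.ext_coord ?_ ?_, hq.ext_coord ?_ ?_⟩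
    · linarith
    · linarith
    · rw [xCoord_zero]; linarith
    · rw [yCoord_zero]; linarith
  · change z ∈ (graph q A).K 1 at hz
    change z' ∈ A at hz'
    change xCoord q (F q 0 z) = xCoord q (F q 1 z') at hx
    obtain ⟨⟨m0, m1, m2, m3⟩, m⟩ := hA.coord_of_mem_K_one hq hz
    obtain ⟨n0, n1, n2, n3⟩ := hA.mem_unit_square hq hz'
    linarith
  · change z ∈ (graph q A).K 1 at hz
    change z' ∈ A at hz'
    change yCoord q (F q 0 z) = yCoord q (F q 3 z') at hy
    obtain ⟨⟨m0, m1, m2, m3⟩, m⟩ := hA.coord_of_mem_K_one hq hz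
    obtain ⟨n0, n1, n2, n3⟩ := hA.mem_unit_square hq hz'
    linarith
  · change z ∈ (graph q A).K 1 at hz
    change z' ∈ A at hz'
    change xCoord q (F q 0 z) = xCoord q (F q 4 z') at hx
    change yCoord q (F q 0 z) = yCoord q (F q 4 z') at hy
    obtain ⟨⟨m0, m1, m2, m3⟩, m⟩ := hA.coord_of_mem_K_one hq hz
    obtain ⟨n0, n1, n2, n3⟩ := hA.mem_unit_square hq hz'
    obtain ⟨p1, p2⟩ : xCoord q z ≤ 2 / 3 ∧ yCoord q z ≤ 2 / 3 := by
      rcases m with m | m | m | m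
      · constructor <;> linarith
      · constructor <;> linarith
      · constructor <;> linarith
      · exact m
    refine .inr (.inl ⟨rfl, rfl, hq.ext_coord ?_ ?_, hq.ext_coord ?_ ?_⟩)
    · linarith
    · linarith
    · rw [xCoord_zero]; linarith
    · rw [yCoord_zero]; linarith
  · change z ∈ A at hz
    change z' ∈ A at hz'
    change yCoord q (F q 1 z) = yCoord q (F q 3 z') at hy
    obtain ⟨m0, m1, m2, m3⟩ := hA.mem_unit_square hq hz
    obtain ⟨n0, n1, n2, n3⟩ := hA.mem_unit_square hq hz'
    linarith
  · change z ∈ A at hz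
    change z' ∈ A at hz'
    change xCoord q (F q 1 z) = xCoord q (F q 4 z') at hx
    change yCoord q (F q 1 z) = yCoord q (F q 4 z') at hy
    obtain ⟨m0, m1, m2, m3⟩ := hA.mem_unit_square hq hz
    obtain ⟨n0, n1, n2, n3⟩ := hA.mem_unit_square hq hz'
    refine .inr (.inr (.inl ⟨rfl, rfl, hq.ext_coord ?_ ?_, hq.ext_coord ?_ ?_⟩))
    · rw [hq.xCoord_three]; linarith
    · rw [hq.yCoord_three]; linarith
    · rw [hq.xCoord_one]; linarith
    · rw [hq.yCoord_one]; linarith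
  · change z ∈ A at hz
    change z' ∈ A at hz'
    change xCoord q (F q 3 z) = xCoord q (F q 4 z') at hx
    change yCoord q (F q 3 z) = yCoord q (F q 4 z') at hy
    obtain ⟨m0, m1, m2, m3⟩ := hA.mem_unit_square hq hz
    obtain ⟨n0, n1, n2, n3⟩ := hA.mem_unit_square hq hz'
    refine .inr (.inr (.inr ⟨rfl, rfl, hq.ext_coord ?_ ?_, hq.ext_coord ?_ ?_⟩))
    · rw [hq.xCoord_one]; linarith
    · rw [hq.yCoord_one]; linarith
    · rw [hq.xCoord_three]; linarith
    · rw [hq.yCoord_three]; linarith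

/-- A common point of two different cells of an island is a tip of each of them. -/
theorem IsVicsekSet.mem_tips_of_coincidence (hq : IsSquare q) (hA : IsVicsekSet q A)
    {e e' : Fin 6} (he : e ≠ e') (hi : (graph q A).init e = (graph q A).init e') {z z' : Plane}
    (hz : z ∈ (graph q A).K ((graph q A).fin e)) (hz' : z' ∈ (graph q A).K ((graph q A).fin e'))
    (h : (graph q A).ψ e z = (graph q A).ψ e' z') :
    z ∈ range (tips q ((graph q A).fin e)) := by
  rcases lt_or_gt_of_ne he with hlt | hlt
  · rcases hA.coincidence hq hlt hi hz hz' h with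
      ⟨rfl, rfl, h1, -⟩ | ⟨rfl, rfl, h1, -⟩ | ⟨rfl, rfl, h1, -⟩ | ⟨rfl, rfl, h1, -⟩
    exacts [⟨2, h1.symm⟩, ⟨2, h1.symm⟩, ⟨3, h1.symm⟩, ⟨1, h1.symm⟩]
  · rcases hA.coincidence hq hlt hi.symm hz' hz h.symm with
      ⟨rfl, rfl, -, h1⟩ | ⟨rfl, rfl, -, h1⟩ | ⟨rfl, rfl, -, h1⟩ | ⟨rfl, rfl, -, h1⟩
    exacts [⟨0, h1.symm⟩, ⟨0, h1.symm⟩, ⟨1, h1.symm⟩, ⟨3, h1.symm⟩]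

theorem IsSquare.coord_tips (hq : IsSquare q) (s : Fin 2) :
    (xCoord q (tips q s 0) = 0 ∧ yCoord q (tips q s 0) = 0) ∧
    (xCoord q (tips q s 1) = 1 ∧ yCoord q (tips q s 1) = 0) ∧
    (xCoord q (tips q s 2) = (if s = 0 then 1 else 2 / 3) ∧
      yCoord q (tips q s 2) = if s = 0 then 1 else 2 / 3) ∧
    (xCoord q (tips q s 3) = 0 ∧ yCoord q (tips q s 3) = 1) := by
  have h0 : tips q s 0 = q 0 := by fin_cases s <;> rfl
  have h1 : tips q s 1 = q 1 := by fin_cases s <;> rfl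
  have h3 : tips q s 3 = q 3 := by fin_cases s <;> rfl
  rw [h0, h1, h3, xCoord_zero, yCoord_zero, hq.xCoord_one, hq.yCoord_one, hq.xCoord_three,
    hq.yCoord_three]
  refine ⟨⟨rfl, rfl⟩, ⟨rfl, rfl⟩, ?_, rfl, rfl⟩
  fin_cases s
  · exact ⟨hq.xCoord_two, hq.yCoord_two⟩
  · change xCoord q (F q 2 (q 0)) = _ ∧ yCoord q (F q 2 (q 0)) = _
    rw [(hq.xCoord_F _).2.2.1, (hq.yCoord_F _).2.2.1, xCoord_zero, yCoord_zero]
    norm_num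

theorem IsSquare.tips_injective (hq : IsSquare q) (s : Fin 2) : Function.Injective (tips q s) := by
  obtain ⟨⟨a0, b0⟩, ⟨a1, b1⟩, ⟨a2, b2⟩, a3, b3⟩ := hq.coord_tips s
  intro j k h
  have hx := congrArg (xCoord q) h
  have hy := congrArg (yCoord q) h
  fin_cases j <;> fin_cases k <;> first | rfl | skip
  all_goals
    exfalso
    simp only [Fin.zero_eta, Fin.mk_one, Fin.reduceFinMk, a0, a1, a2, a3, b0, b1, b2, b3] at hx hy
    revert hx hy
    fin_cases s <;> norm_num

theorem IsSquare.center_notMem_tips (hq : IsSquare q) (s : Fin 2) :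
    center q ∉ range (tips q s) := by
  rintro ⟨k, h⟩
  obtain ⟨⟨a0, b0⟩, ⟨a1, b1⟩, ⟨a2, b2⟩, a3, b3⟩ := hq.coord_tips s
  have hx := congrArg (xCoord q) h
  rw [hq.xCoord_center] at hx
  fin_cases k <;>
    simp only [Fin.zero_eta, Fin.mk_one, Fin.reduceFinMk, a0, a1, a2, a3] at hx <;> revert hx
  all_goals fin_cases s <;> norm_num

/-- The points in which the cells of an island meet. -/
theorem IsSquare.junctions (hq : IsSquare q) :
    F q 4 (q 0) = F q 0 (F q 2 (q 0)) ∧ F q 4 (q 1) = F q 1 (q 3) ∧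
    F q 4 (q 3) = F q 3 (q 1) ∧ F q 4 (q 2) = F q 2 (q 0) := by
  have j1 : F q 4 (q 0) = F q 0 (F q 2 (q 0)) := by
    apply hq.ext_coord
    · rw [(hq.xCoord_F _).2.2.2.2, (hq.xCoord_F _).1, (hq.xCoord_F _).2.2.1, xCoord_zero]
      norm_num
    · rw [(hq.yCoord_F _).2.2.2.2, (hq.yCoord_F _).1, (hq.yCoord_F _).2.2.1, yCoord_zero]
      norm_num
  have j2 : F q 4 (q 1) = F q 1 (q 3) := by
    apply hq.ext_coord
    · rw [(hq.xCoord_F _).2.2.2.2, (hq.xCoord_F _).2.1, hq.xCoord_one, hq.xCoord_three]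
      norm_num
    · rw [(hq.yCoord_F _).2.2.2.2, (hq.yCoord_F _).2.1, hq.yCoord_one, hq.yCoord_three]
      norm_num
  have j3 : F q 4 (q 3) = F q 3 (q 1) := by
    apply hq.ext_coord
    · rw [(hq.xCoord_F _).2.2.2.2, (hq.xCoord_F _).2.2.2.1, hq.xCoord_one, hq.xCoord_three]
      norm_num
    · rw [(hq.yCoord_F _).2.2.2.2, (hq.yCoord_F _).2.2.2.1, hq.yCoord_one, hq.yCoord_three]
      norm_num
  have j4 : F q 4 (q 2) = F q 2 (q 0) := by
    apply hq.ext_coord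
    · rw [(hq.xCoord_F _).2.2.1, (hq.xCoord_F _).2.2.2.2, xCoord_zero, hq.xCoord_two]; norm_num
    · rw [(hq.yCoord_F _).2.2.1, (hq.yCoord_F _).2.2.2.2, yCoord_zero, hq.yCoord_two]; norm_num
  exact ⟨j1, j2, j3, j4⟩

theorem IsVicsekSet.tips_mem (hq : IsSquare q) (hA : IsVicsekSet q A) (s : Fin 2) (k : Fin 4) :
    tips q s k ∈ (graph q A).K s := by
  fin_cases s
  · fin_cases k <;> exact hA.vertex_mem _
  · fin_cases k
    · exact .inl (.inl (.inl ⟨q 0, hA.vertex_mem 0, by rw [F_zero]; change _ = q 0; module⟩))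
    · exact .inl (.inl (.inr ⟨q 1, hA.vertex_mem 1, by rw [F_one]; change _ = q 1; module⟩))
    · exact .inr ⟨q 2, hA.vertex_mem 2, hq.junctions.2.2.2⟩
    · exact .inl (.inr ⟨q 3, hA.vertex_mem 3, by rw [F_three]; change _ = q 3; module⟩)

theorem IsVicsekSet.ψ_mem (hA : IsVicsekSet q A) (e : Fin 6) {z : Plane}
    (hz : z ∈ (graph q A).K ((graph q A).fin e)) :
    (graph q A).ψ e z ∈ (graph q A).K ((graph q A).init e) := by
  fin_cases e
  · exact hA.K_one_subset hz
  · exact hA.F_mem 2 hz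
  · exact .inl (.inl (.inl ⟨z, hA.K_one_subset hz, rfl⟩))
  · exact .inl (.inl (.inr ⟨z, hz, rfl⟩))
  · exact .inl (.inr ⟨z, hz, rfl⟩)
  · exact .inr ⟨z, hz, rfl⟩

theorem IsVicsekSet.map_mem (hA : IsVicsekSet q A) {w : List (Fin 6)} {s : Fin 2}
    (hw : (graph q A).IsWalk s w) {z : Plane}
    (hz : z ∈ (graph q A).K ((graph q A).endpoint s w)) :
    (graph q A).map w z ∈ (graph q A).K s := by
  induction w generalizing s with
  | nil => exact hz
  | cons e w ih =>
    obtain ⟨rfl, hw⟩ := hw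
    exact hA.ψ_mem e (ih hw hz)

theorem graph_ψ_injective (q : Fin 4 → Plane) (A : Set Plane) (e : Fin 6) :
    Function.Injective ((graph q A).ψ e) := by
  have key : ∀ (s : ℝ) (p : Plane), s ≠ 0 → Function.Injective fun x : Plane => s • x + p :=
    fun s p hs => (add_left_injective p).comp (smul_right_injective _ hs)
  fin_cases e
  · exact Function.injective_id
  · exact key _ _ (by norm_num)
  · exact key _ _ (by norm_num)
  · exact key _ _ (by norm_num)
  · exact key _ _ (by norm_num)
  · exact key _ _ (by norm_num)

theorem graph_map_injective (q : Fin 4 → Plane) (A : Set Plane) (w : List (Fin 6)) :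
    Function.Injective ((graph q A).map w) := by
  induction w with
  | nil => exact Function.injective_id
  | cons e w ih => exact (graph_ψ_injective q A e).comp ih

/-- A tip of an island that lies in one of its cells is a tip of that cell. -/
theorem IsVicsekSet.mem_tips_of_ψ_mem (hq : IsSquare q) (hA : IsVicsekSet q A) (e : Fin 6)
    {z : Plane} (hz : z ∈ (graph q A).K ((graph q A).fin e))
    (h : (graph q A).ψ e z ∈ range (tips q ((graph q A).init e))) :
    z ∈ range (tips q ((graph q A).fin e)) := by
  obtain ⟨k, hk⟩ := h
  have hx := congrArg (xCoord q) hk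
  have hy := congrArg (yCoord q) hk
  obtain ⟨k0, k1, k2, k3, k4⟩ := hq.xCoord_F z
  obtain ⟨l0, l1, l2, l3, l4⟩ := hq.yCoord_F z
  obtain ⟨⟨a0, b0⟩, ⟨a1, b1⟩, ⟨a2, b2⟩, a3, b3⟩ := hq.coord_tips 0
  obtain ⟨⟨c0, d0⟩, ⟨c1, d1⟩, ⟨c2, d2⟩, c3, d3⟩ := hq.coord_tips 1
  simp only [↓reduceIte, one_ne_zero] at a2 b2 c2 d2
  have hz1 : z ∈ A := by
    fin_cases e
    · exact hA.K_one_subset hz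
    · exact hz
    · exact hA.K_one_subset hz
    all_goals exact hz
  obtain ⟨n0, n1, n2, n3⟩ := hA.mem_unit_square hq hz1
  fin_cases e
  · obtain ⟨-, m⟩ := hA.coord_of_mem_K_one hq hz
    fin_cases k
    · exact ⟨0, hk⟩
    · exact ⟨1, hk⟩
    · exfalso
      change xCoord q (tips q 0 2) = xCoord q z at hx
      change yCoord q (tips q 0 2) = yCoord q z at hy
      rcases m with m | m | m | m <;> linarith
    · exact ⟨3, hk⟩
  · change xCoord q (tips q 0 k) = xCoord q (F q 2 z) at hx
    change yCoord q (tips q 0 k) = yCoord q (F q 2 z) at hy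
    refine ⟨2, hq.ext_coord (?_ : xCoord q (tips q 0 2) = _) (?_ : yCoord q (tips q 0 2) = _)⟩ <;>
    fin_cases k <;> simp only [Fin.zero_eta, Fin.mk_one, Fin.reduceFinMk] at hx hy <;> linarith
  · change xCoord q (tips q 1 k) = xCoord q (F q 0 z) at hx
    change yCoord q (tips q 1 k) = yCoord q (F q 0 z) at hy
    refine ⟨0, hq.ext_coord (?_ : xCoord q (tips q 1 0) = _) (?_ : yCoord q (tips q 1 0) = _)⟩ <;>
    fin_cases k <;> simp only [Fin.zero_eta, Fin.mk_one, Fin.reduceFinMk] at hx hy <;> linarith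
  · change xCoord q (tips q 1 k) = xCoord q (F q 1 z) at hx
    change yCoord q (tips q 1 k) = yCoord q (F q 1 z) at hy
    refine ⟨1, hq.ext_coord (?_ : xCoord q (tips q 0 1) = _) (?_ : yCoord q (tips q 0 1) = _)⟩ <;>
    fin_cases k <;> simp only [Fin.zero_eta, Fin.mk_one, Fin.reduceFinMk] at hx hy <;> linarith
  · change xCoord q (tips q 1 k) = xCoord q (F q 3 z) at hx
    change yCoord q (tips q 1 k) = yCoord q (F q 3 z) at hy
    refine ⟨3, hq.ext_coord (?_ : xCoord q (tips q 0 3) = _) (?_ : yCoord q (tips q 0 3) = _)⟩ <;>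
    fin_cases k <;> simp only [Fin.zero_eta, Fin.mk_one, Fin.reduceFinMk] at hx hy <;> linarith
  · change xCoord q (tips q 1 k) = xCoord q (F q 4 z) at hx
    change yCoord q (tips q 1 k) = yCoord q (F q 4 z) at hy
    refine ⟨2, hq.ext_coord (?_ : xCoord q (tips q 0 2) = _) (?_ : yCoord q (tips q 0 2) = _)⟩ <;>
    fin_cases k <;> simp only [Fin.zero_eta, Fin.mk_one, Fin.reduceFinMk] at hx hy <;> linarith

theorem IsVicsekSet.mem_tips_of_map_mem (hq : IsSquare q) (hA : IsVicsekSet q A)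
    {w : List (Fin 6)} {s : Fin 2} (hw : (graph q A).IsWalk s w) {z : Plane}
    (hz : z ∈ (graph q A).K ((graph q A).endpoint s w))
    (h : (graph q A).map w z ∈ range (tips q s)) :
    z ∈ range (tips q ((graph q A).endpoint s w)) := by
  induction w generalizing s with
  | nil => exact h
  | cons e w ih =>
    obtain ⟨rfl, hw⟩ := hw
    exact ih hw hz (hA.mem_tips_of_ψ_mem hq e (hA.map_mem hw hz) h)

/-! ### The boundaries of the islands -/

namespace GraphDirected

variable {X S E : Type*} (G : GraphDirected X S E)

theorem map_append (v w : List E) : G.map (v ++ w) = G.map v ∘ G.map w := by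
  induction v with
  | nil => rfl
  | cons e v ih => simp only [List.cons_append, map, ih]; rfl

theorem endpoint_append (s : S) (v w : List E) :
    G.endpoint s (v ++ w) = G.endpoint (G.endpoint s v) w := by
  induction v generalizing s with
  | nil => rfl
  | cons e v ih => exact ih _

theorem isWalk_append (s : S) (v w : List E) :
    G.IsWalk s (v ++ w) ↔ G.IsWalk s v ∧ G.IsWalk (G.endpoint s v) w := by
  induction v generalizing s with
  | nil => simp [IsWalk, endpoint]
  | cons e v ih => simp [IsWalk, endpoint, ih, and_assoc]

theorem island_concat (w : List E) (e : E) :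
    G.island (w ++ [e]) = G.map w '' (G.ψ e '' G.K (G.fin e)) := by
  rw [island, map_append, endpoint_append, image_comp]
  rfl

end GraphDirected

theorem IsVicsekSet.boundary_subset (hq : IsSquare q) (hA : IsVicsekSet q A) (s : Fin 2) :
    (graph q A).boundary s ⊆ range (tips q s) := by
  rintro x ⟨w, -, hw, rfl, hx, p, v, rfl, hv, e₁, e₂, hne, h1, h2, hx1, hx2⟩
  have hinj := graph_map_injective q A
  rw [GraphDirected.island, (hinj _).mem_set_image] at hx
  rw [GraphDirected.island_concat, GraphDirected.map_append, Function.comp_apply,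
    (hinj p).mem_set_image] at hx1 hx2
  rw [GraphDirected.isWalk_append] at hw
  rw [GraphDirected.endpoint_append] at hx ⊢
  obtain ⟨-, hw⟩ := hw
  obtain ⟨z1, hz1, e1⟩ := hx1
  obtain ⟨z2, hz2, e2⟩ := hx2
  match v, hv with
  | e :: v, _ =>
    obtain ⟨he, hw⟩ := hw
    refine hA.mem_tips_of_map_mem hq hw hx ?_
    by_cases hee : e = e₁
    · refine hA.mem_tips_of_coincidence hq (e' := e₂) (fun h => hne (hee.symm.trans h))
        (he.trans h2.symm) (hA.map_mem hw hx) hz2 e2.symm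
    · exact hA.mem_tips_of_coincidence hq (e' := e₁) hee (he.trans h1.symm)
        (hA.map_mem hw hx) hz1 e1.symm

theorem IsVicsekSet.boundary_eq (hq : IsSquare q) (hA : IsVicsekSet q A) (s : Fin 2) :
    (graph q A).boundary s = range (tips q s) := by
  refine (hA.boundary_subset hq s).antisymm ?_
  obtain ⟨j1, j2, j3, j4⟩ := hq.junctions
  have t0 : F q 2 (q 0) ∈ (graph q A).K 1 := hA.tips_mem hq 1 2
  have hcrit0 : F q 2 (q 0) ∈ (graph q A).critical [] :=
    ⟨0, 1, by decide, rfl, rfl, ⟨_, t0, rfl⟩, ⟨q 0, hA.vertex_mem 0, rfl⟩⟩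
  have hcrit1 : F q 4 (q 0) ∈ (graph q A).critical [0] ∧ F q 4 (q 1) ∈ (graph q A).critical [0] ∧
      F q 4 (q 3) ∈ (graph q A).critical [0] :=
    ⟨⟨5, 2, by decide, rfl, rfl, ⟨_, hA.vertex_mem 0, rfl⟩, ⟨F q 2 (q 0), t0, j1.symm⟩⟩,
      ⟨5, 3, by decide, rfl, rfl, ⟨_, hA.vertex_mem 1, rfl⟩, ⟨q 3, hA.vertex_mem 3, j2.symm⟩⟩,
      ⟨5, 4, by decide, rfl, rfl, ⟨_, hA.vertex_mem 3, rfl⟩, ⟨q 1, hA.vertex_mem 1, j3.symm⟩⟩⟩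
  rintro _ ⟨k, rfl⟩
  fin_cases s
  · refine ⟨[0, 5], by simp, ⟨rfl, rfl, trivial⟩, rfl, ⟨_, hA.vertex_mem k, ?_⟩, ?_⟩
    · fin_cases k <;> rfl
    · fin_cases k
      · exact ⟨[0], [5], rfl, by simp, hcrit1.1⟩
      · exact ⟨[0], [5], rfl, by simp, hcrit1.2.1⟩
      · exact ⟨[], [0, 5], rfl, by simp, (j4 ▸ hcrit0 : F q 4 (q 2) ∈ _)⟩
      · exact ⟨[0], [5], rfl, by simp, hcrit1.2.2⟩
  · have hmem : (graph q A).map [0, 5, 0] (tips q 1 k) ∈ (graph q A).island [0, 5, 0] :=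
      ⟨_, hA.tips_mem hq 1 k, rfl⟩
    fin_cases k
    · exact ⟨[0, 5, 0], by simp, ⟨rfl, rfl, rfl, trivial⟩, rfl, hmem, [0], [5, 0], rfl, by simp,
        hcrit1.1⟩
    · exact ⟨[0, 5, 0], by simp, ⟨rfl, rfl, rfl, trivial⟩, rfl, hmem, [0], [5, 0], rfl, by simp,
        hcrit1.2.1⟩
    · exact ⟨[0], by simp, ⟨rfl, trivial⟩, rfl, ⟨_, t0, rfl⟩, [], [0], rfl, by simp, hcrit0⟩
    · exact ⟨[0, 5, 0], by simp, ⟨rfl, rfl, rfl, trivial⟩, rfl, hmem, [0], [5, 0], rfl, by simp,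
        hcrit1.2.2⟩

end Vicsek

namespace Vicsek

/-! ### Legendre duality for resistance forms on four points -/

/-- `P` is the energy of currents (vectors of total `0`) that is dual to the energy `Q` of
potentials. -/
structure IsConjugate (Q P : (Fin 4 → ℝ) → ℝ) : Prop where
  le : ∀ i x : Fin 4 → ℝ, ∑ k, i k = 0 → 2 * ∑ k, i k * x k ≤ Q x + P i
  exists_potential : ∀ i : Fin 4 → ℝ, ∑ k, i k = 0 → ∃ x, 2 * ∑ k, i k * x k = Q x + P i
  exists_current : ∀ x, ∃ i : Fin 4 → ℝ, ∑ k, i k = 0 ∧ 2 * ∑ k, i k * x k = Q x + P i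
  smul : ∀ (c : ℝ) (i : Fin 4 → ℝ), ∑ k, i k = 0 → P (c • i) = c ^ 2 * P i
  shift : ∀ (x : Fin 4 → ℝ) (c : ℝ), Q (fun k => x k + c) = Q x
  pos : ∀ i : Fin 4 → ℝ, ∑ k, i k = 0 → i ≠ 0 → 0 < P i

namespace IsConjugate

variable {Q Q' P P' : (Fin 4 → ℝ) → ℝ}

theorem dual_unique (h : IsConjugate Q P) (h' : IsConjugate Q P') {i : Fin 4 → ℝ}
    (hi : ∑ k, i k = 0) : P i = P' i := by
  obtain ⟨x, hx⟩ := h.exists_potential i hi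
  obtain ⟨y, hy⟩ := h'.exists_potential i hi
  linarith [h.le i y hi, h'.le i x hi]

theorem form_unique (h : IsConjugate Q P) (h' : IsConjugate Q' P')
    (hP : ∀ i : Fin 4 → ℝ, ∑ k, i k = 0 → P i = P' i) : Q = Q' := by
  funext x
  obtain ⟨i, hi, hx⟩ := h.exists_current x
  obtain ⟨j, hj, hy⟩ := h'.exists_current x
  linarith [h.le j x hj, h'.le i x hi, hP i hi, hP j hj]

theorem le_scaled (h : IsConjugate Q P) {r : ℝ} (hr : 0 < r) {i : Fin 4 → ℝ}
    (hi : ∑ k, i k = 0) (x : Fin 4 → ℝ) : 2 * ∑ k, i k * x k ≤ r⁻¹ * Q x + r * P i := by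
  have h1 := h.le (r • i) x (by simp [← Finset.mul_sum, hi])
  rw [h.smul r i hi] at h1
  simp only [Pi.smul_apply, smul_eq_mul, mul_assoc, ← Finset.mul_sum] at h1
  have h2 := mul_le_mul_of_nonneg_left h1 (inv_pos.2 hr).le
  have e1 : r⁻¹ * (2 * (r * ∑ k, i k * x k)) = 2 * ∑ k, i k * x k := by field_simp
  have e2 : r⁻¹ * (Q x + r ^ 2 * P i) = r⁻¹ * Q x + r * P i := by field_simp
  rwa [e1, e2] at h2

theorem exists_scaled (h : IsConjugate Q P) {r : ℝ} (hr : 0 < r) {i : Fin 4 → ℝ}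
    (hi : ∑ k, i k = 0) (j : Fin 4) (v : ℝ) :
    ∃ x : Fin 4 → ℝ, x j = v ∧ 2 * ∑ k, i k * x k = r⁻¹ * Q x + r * P i := by
  obtain ⟨x, hx⟩ := h.exists_potential (r • i) (by simp [← Finset.mul_sum, hi])
  refine ⟨fun k => x k + (v - x j), by ring, ?_⟩
  rw [h.shift]
  rw [h.smul r i hi] at hx
  simp only [Pi.smul_apply, smul_eq_mul, mul_assoc, ← Finset.mul_sum] at hx
  have e1 : r⁻¹ * (2 * (r * ∑ k, i k * x k)) = 2 * ∑ k, i k * x k := by field_simp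
  have e2 : r⁻¹ * (Q x + r ^ 2 * P i) = r⁻¹ * Q x + r * P i := by field_simp
  rw [← e2, ← hx, e1]
  simp only [mul_add, Finset.sum_add_distrib, ← Finset.sum_mul, hi, zero_mul, add_zero]

end IsConjugate

/-- A symmetric positive semidefinite operator whose kernel consists of the constants has a dual
form. -/
theorem exists_isConjugate (T : (Fin 4 → ℝ) →ₗ[ℝ] (Fin 4 → ℝ))
    (hs : ∀ x y, ∑ k, x k * T y k = ∑ k, y k * T x k) (hp : ∀ x, 0 ≤ ∑ k, x k * T x k)
    (hk : ∀ x, T x = 0 ↔ ∃ c : ℝ, x = fun _ => c) :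
    ∃ P, IsConjugate (fun x => ∑ k, x k * T x k) P := by
  have hconst : ∀ c : ℝ, T (fun _ => c) = 0 := fun c => (hk _).2 ⟨c, rfl⟩
  have hsum : ∀ x, ∑ k, T x k = 0 := by
    intro x
    have := hs (fun _ => 1) x
    rw [hconst] at this
    simpa using this
  let J : (Fin 4 → ℝ) →ₗ[ℝ] (Fin 4 → ℝ) :=
    { toFun := fun x _ => ∑ k, x k
      map_add' := fun x y => by funext; simp [Finset.sum_add_distrib]
      map_smul' := fun c x => by funext; simp [Finset.mul_sum] }
  have hJ : ∀ x j, J x j = ∑ k, x k := fun _ _ => rfl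
  have htot : ∀ x, ∑ k, (T + J) x k = 4 * ∑ k, x k := by
    intro x
    simp only [LinearMap.add_apply, Pi.add_apply, Finset.sum_add_distrib, hsum, hJ]
    simp
  have hzero : ∀ x, ∑ k, x k = 0 → (T + J) x = T x := by
    intro x hx
    funext j
    simp [hJ, hx]
  have hinj : Function.Injective (T + J) := by
    rw [← LinearMap.ker_eq_bot, LinearMap.ker_eq_bot']
    intro x hx
    have h0 : ∑ k, x k = 0 := by
      have := htot x
      rw [hx] at this
      simpa using this.symm
    rw [hzero x h0] at hx
    obtain ⟨c, rfl⟩ := (hk x).1 hx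
    funext k
    simpa using h0
  have hsurj : ∀ i : Fin 4 → ℝ, ∑ k, i k = 0 → ∃ x, T x = i := by
    intro i hi
    obtain ⟨x, hx⟩ := LinearMap.injective_iff_surjective.1 hinj i
    have h0 : ∑ k, x k = 0 := by
      have := htot x
      rw [hx, hi] at this
      linarith
    exact ⟨x, by rw [← hzero x h0, hx]⟩
  have hindep : ∀ x y, T x = T y → ∑ k, x k * T x k = ∑ k, y k * T y k := by
    intro x y h
    calc ∑ k, x k * T x k = ∑ k, x k * T y k := by rw [h]
      _ = ∑ k, y k * T x k := hs x y
      _ = ∑ k, y k * T y k := by rw [h]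
  choose! g hg using hsurj
  have hP : ∀ y, ∑ k, g (T y) k * T (g (T y)) k = ∑ k, y k * T y k :=
    fun y => hindep _ _ (hg _ (hsum y))
  refine ⟨fun i => ∑ k, g i k * T (g i) k, ?_, ?_, ?_, ?_, ?_, ?_⟩
  · intro i x hi
    obtain ⟨y, rfl⟩ : ∃ y, T y = i := ⟨_, hg i hi⟩
    rw [hP]
    have h1 := hp (x - y)
    have h2 := hs x y
    simp only [map_sub, Pi.sub_apply, sub_mul, mul_sub, Finset.sum_sub_distrib] at h1
    have h3 : ∑ k, T y k * x k = ∑ k, x k * T y k := by simp only [mul_comm]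
    rw [h3]
    linarith
  · intro i hi
    refine ⟨g i, ?_⟩
    have h3 : ∑ k, i k * g i k = ∑ k, g i k * T (g i) k := by
      rw [hg i hi]; simp only [mul_comm]
    rw [h3]; ring
  · intro x
    refine ⟨T x, hsum x, ?_⟩
    have h3 : ∑ k, T x k * x k = ∑ k, x k * T x k := by simp only [mul_comm]
    rw [hP, h3]; ring
  · intro c i hi
    obtain ⟨y, rfl⟩ : ∃ y, T y = i := ⟨_, hg i hi⟩
    rw [hP, ← map_smul, hP]
    simp only [map_smul, Pi.smul_apply, smul_eq_mul, Finset.mul_sum]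
    exact Finset.sum_congr rfl fun k _ => by ring
  · intro x c
    have h1 : T (fun k => x k + c) = T x := by
      have : (fun k => x k + c) = x + fun _ => c := rfl
      rw [this, map_add, hconst, add_zero]
    exact hindep _ _ h1
  · intro i hi hne
    refine lt_of_le_of_ne (hp _) fun h0 => hne ?_
    rw [← hg i hi]
    set x := g i with hx
    clear_value x
    -- a zero of the form is a minimum, hence a critical point
    by_contra hT
    have hm : 0 < ∑ k, T x k * T x k := by
      obtain ⟨k, hk⟩ := Function.ne_iff.1 hT
      exact Finset.sum_pos' (fun _ _ => mul_self_nonneg _)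
        ⟨k, Finset.mem_univ _, mul_self_pos.2 hk⟩
    set m := ∑ k, T x k * T x k with hmdef
    have key : ∀ t : ℝ, 0 ≤ -2 * t * m + t ^ 2 * ∑ k, T x k * T (T x) k := by
      intro t
      have h1 := hp (x - t • T x)
      have h2 := hs x (T x)
      simp only [map_sub, map_smul, Pi.sub_apply, Pi.smul_apply, smul_eq_mul, sub_mul, mul_sub,
        Finset.sum_sub_distrib] at h1
      have e1 : ∑ k, x k * (t * T (T x) k) = t * m := by
        rw [hmdef, ← h2, Finset.mul_sum]; exact Finset.sum_congr rfl fun _ _ => by ring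
      have e2 : ∑ k, t * T x k * T x k = t * m := by
        rw [hmdef, Finset.mul_sum]; exact Finset.sum_congr rfl fun _ _ => by ring
      have e3 : ∑ k, t * T x k * (t * T (T x) k) = t ^ 2 * ∑ k, T x k * T (T x) k := by
        rw [Finset.mul_sum]; exact Finset.sum_congr rfl fun _ _ => by ring
      rw [e1, e2, e3, ← h0] at h1
      linarith
    set N := ∑ k, T x k * T (T x) k with hN
    have hN0 : 0 ≤ N := hp (T x)
    have h1 := key (m / (N + 1))
    have h2 : -2 * (m / (N + 1)) * m + (m / (N + 1)) ^ 2 * N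
        = -(m ^ 2 * (N + 2)) / (N + 1) ^ 2 := by field_simp; ring
    rw [h2] at h1
    have : 0 < m ^ 2 * (N + 2) / (N + 1) ^ 2 := by positivity
    rw [neg_div] at h1
    linarith

/-! ### Star-shaped networks -/

/-- The potential at the centre of a star that minimizes the energy. -/
noncomputable def starMean (ρ x : Fin 4 → ℝ) : ℝ := (∑ k, x k / ρ k) / ∑ k, (ρ k)⁻¹

/-- The trace on its tips of a star-shaped network. -/
noncomputable def starForm (ρ x : Fin 4 → ℝ) : ℝ := ∑ k, (x k - starMean ρ x) ^ 2 / ρ k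

section Star

variable {ρ : Fin 4 → ℝ}

theorem sum_inv_pos (hρ : ∀ k, 0 < ρ k) : 0 < ∑ k, (ρ k)⁻¹ :=
  Finset.sum_pos (fun k _ => inv_pos.2 (hρ k)) Finset.univ_nonempty

theorem sum_sub_starMean (hρ : ∀ k, 0 < ρ k) (x : Fin 4 → ℝ) :
    ∑ k, (x k - starMean ρ x) / ρ k = 0 := by
  have h := (sum_inv_pos hρ).ne'
  simp only [sub_div, Finset.sum_sub_distrib]
  have : ∑ k, starMean ρ x / ρ k = starMean ρ x * ∑ k, (ρ k)⁻¹ := by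
    rw [Finset.mul_sum]; rfl
  rw [this, starMean, div_mul_cancel₀ _ h, sub_self]

/-- The energy of a star as a function of the potential at the centre. -/
theorem sum_sq_sub_div (hρ : ∀ k, 0 < ρ k) (x : Fin 4 → ℝ) (o : ℝ) :
    ∑ k, (x k - o) ^ 2 / ρ k
      = starForm ρ x + (o - starMean ρ x) ^ 2 * ∑ k, (ρ k)⁻¹ := by
  have h := sum_sub_starMean hρ x
  have h2 : ∑ k, (x k - o) ^ 2 / ρ k = ∑ k, ((x k - starMean ρ x) ^ 2 / ρ k
      - 2 * (o - starMean ρ x) * ((x k - starMean ρ x) / ρ k)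
      + (o - starMean ρ x) ^ 2 * (ρ k)⁻¹) :=
    Finset.sum_congr rfl fun k _ => by have := (hρ k).ne'; field_simp; ring
  rw [h2, Finset.sum_add_distrib, Finset.sum_sub_distrib, ← Finset.mul_sum, h, ← Finset.mul_sum,
    starForm]
  ring

theorem starForm_le (hρ : ∀ k, 0 < ρ k) (x : Fin 4 → ℝ) (o : ℝ) :
    starForm ρ x ≤ ∑ k, (x k - o) ^ 2 / ρ k := by
  rw [sum_sq_sub_div hρ]
  have := sum_inv_pos hρ
  have : 0 ≤ (o - starMean ρ x) ^ 2 * ∑ k, (ρ k)⁻¹ := by positivity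
  linarith

theorem isConjugate_starForm (hρ : ∀ k, 0 < ρ k) :
    IsConjugate (starForm ρ) fun i => ∑ k, ρ k * i k ^ 2 where
  le i x hi := by
    have h1 : ∑ k, i k * x k = ∑ k, i k * (x k - starMean ρ x) := by
      simp only [mul_sub, Finset.sum_sub_distrib, ← Finset.sum_mul, hi, zero_mul, sub_zero]
    rw [h1, starForm, Finset.mul_sum, ← Finset.sum_add_distrib]
    refine Finset.sum_le_sum fun k _ => ?_
    have hk := hρ k
    have h2 : 0 ≤ ((x k - starMean ρ x) - ρ k * i k) ^ 2 / ρ k := by positivity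
    have h3 : ((x k - starMean ρ x) - ρ k * i k) ^ 2 / ρ k
        = (x k - starMean ρ x) ^ 2 / ρ k + ρ k * i k ^ 2 - 2 * (i k * (x k - starMean ρ x)) := by
      field_simp; ring
    linarith
  exists_potential i hi := by
    refine ⟨fun k => ρ k * i k, ?_⟩
    have h0 : starMean ρ (fun k => ρ k * i k) = 0 := by
      rw [starMean]
      have : ∑ k, ρ k * i k / ρ k = 0 := by
        rw [← hi]; exact Finset.sum_congr rfl fun k _ => by have := (hρ k).ne'; field_simp
      rw [this, zero_div]
    rw [starForm, h0, Finset.mul_sum, ← Finset.sum_add_distrib]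
    exact Finset.sum_congr rfl fun k _ => by have := (hρ k).ne'; field_simp; ring
  exists_current x := by
    refine ⟨fun k => (x k - starMean ρ x) / ρ k, sum_sub_starMean hρ x, ?_⟩
    have h1 : ∑ k, (x k - starMean ρ x) / ρ k * x k
        = ∑ k, (x k - starMean ρ x) / ρ k * (x k - starMean ρ x) := by
      simp only [mul_sub _ (x _) (starMean ρ x), Finset.sum_sub_distrib, ← Finset.sum_mul,
        sum_sub_starMean hρ x, zero_mul, sub_zero]
    rw [h1, starForm, Finset.mul_sum, ← Finset.sum_add_distrib]
    exact Finset.sum_congr rfl fun k _ => by have := (hρ k).ne'; field_simp; ring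
  smul c i _ := by
    rw [Finset.mul_sum]
    exact Finset.sum_congr rfl fun k _ => by simp only [Pi.smul_apply, smul_eq_mul]; ring
  shift x c := by
    have h := (sum_inv_pos hρ).ne'
    have : starMean ρ (fun k => x k + c) = starMean ρ x + c := by
      simp only [starMean, add_div, Finset.sum_add_distrib]
      congr 1
      rw [div_eq_iff h, Finset.mul_sum]
      rfl
    simp only [starForm, this, add_sub_add_right_eq_sub]
  pos i _ hne := by
    obtain ⟨k, hk⟩ := Function.ne_iff.1 hne
    refine Finset.sum_pos' (fun k _ => mul_nonneg (hρ k).le (sq_nonneg _))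
      ⟨k, Finset.mem_univ _, mul_pos (hρ k) (sq_pos_of_ne_zero hk)⟩

/-- A diagonal quadratic form on the currents determines its coefficients. -/
theorem eq_of_sum_mul_sq_eq {ρ σ : Fin 4 → ℝ}
    (h : ∀ i : Fin 4 → ℝ, ∑ k, i k = 0 → ∑ k, ρ k * i k ^ 2 = ∑ k, σ k * i k ^ 2) : ρ = σ := by
  have h01 := h ![1, -1, 0, 0] (by simp [Fin.sum_univ_four])
  have h02 := h ![1, 0, -1, 0] (by simp [Fin.sum_univ_four])
  have h12 := h ![0, 1, -1, 0] (by simp [Fin.sum_univ_four])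
  have h03 := h ![1, 0, 0, -1] (by simp [Fin.sum_univ_four])
  simp [Fin.sum_univ_four] at h01 h02 h12 h03
  funext k
  fin_cases k <;> simp <;> linarith

theorem starForm_injective {ρ σ : Fin 4 → ℝ} (hρ : ∀ k, 0 < ρ k) (hσ : ∀ k, 0 < σ k)
    (h : starForm ρ = starForm σ) : ρ = σ :=
  eq_of_sum_mul_sq_eq fun _ hi =>
    (isConjugate_starForm hρ).dual_unique (h ▸ isConjugate_starForm hσ) hi

theorem starForm_div (ρ x : Fin 4 → ℝ) {t : ℝ} (ht : 0 < t) :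
    starForm (fun k => ρ k / t) x = t * starForm ρ x := by
  have hm : starMean (fun k => ρ k / t) x = starMean ρ x := by
    have e1 : ∑ k, x k / (ρ k / t) = t * ∑ k, x k / ρ k := by
      rw [Finset.mul_sum]; exact Finset.sum_congr rfl fun k _ => by field_simp
    have e2 : ∑ k, (ρ k / t)⁻¹ = t * ∑ k, (ρ k)⁻¹ := by
      rw [Finset.mul_sum]; exact Finset.sum_congr rfl fun k _ => by rw [inv_div]; rfl
    rw [starMean, starMean, e1, e2, mul_div_mul_left _ _ ht.ne']
  rw [starForm, starForm, hm, Finset.mul_sum]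
  exact Finset.sum_congr rfl fun k _ => by field_simp

end Star

/-! ### The renormalization equations -/

/-- The first renormalization equation. -/
def RenormalizesFst (Q₀ Q₁ : (Fin 4 → ℝ) → ℝ) (r : Fin 6 → ℝ) : Prop :=
  ∀ x : Fin 4 → ℝ, IsLeast {t | ∃ y w : Fin 4 → ℝ, y 0 = x 0 ∧ y 1 = x 1 ∧ y 3 = x 3 ∧
    w 2 = x 2 ∧ y 2 = w 0 ∧ (r 0)⁻¹ * Q₁ y + (r 1)⁻¹ * Q₀ w = t} (Q₀ x)

/-- The second renormalization equation. -/
def RenormalizesSnd (Q₀ Q₁ : (Fin 4 → ℝ) → ℝ) (r : Fin 6 → ℝ) : Prop :=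
  ∀ x : Fin 4 → ℝ, IsLeast {t | ∃ y α β γ : Fin 4 → ℝ, y 0 = x 0 ∧ α 1 = x 1 ∧ β 3 = x 3 ∧
    γ 2 = x 2 ∧ y 2 = γ 0 ∧ α 3 = γ 1 ∧ β 1 = γ 3 ∧
    (r 2)⁻¹ * Q₁ y + (r 3)⁻¹ * Q₀ α + (r 4)⁻¹ * Q₀ β + (r 5)⁻¹ * Q₀ γ = t} (Q₁ x)

variable {Q₀ Q₁ P₀ P₁ : (Fin 4 → ℝ) → ℝ} {r : Fin 6 → ℝ}

theorem RenormalizesFst.dual (h : RenormalizesFst Q₀ Q₁ r) (h₀ : IsConjugate Q₀ P₀)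
    (h₁ : IsConjugate Q₁ P₁) (hr : ∀ e, 0 < r e) {i : Fin 4 → ℝ} (hi : ∑ k, i k = 0) :
    P₀ i = r 0 * P₁ i + r 1 * (i 2 ^ 2 * P₀ ![-1, 0, 1, 0]) := by
  have hd : ∑ k, (![-1, 0, 1, 0] : Fin 4 → ℝ) k = 0 := by simp [Fin.sum_univ_four]
  have hd' : ∑ k, (i 2 • ![-1, 0, 1, 0] : Fin 4 → ℝ) k = 0 := by
    simp only [Pi.smul_apply, ← Finset.smul_sum, hd, smul_zero]
  rw [← h₀.smul _ _ hd]
  apply le_antisymm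
  · obtain ⟨x, hx⟩ := h₀.exists_potential i hi
    obtain ⟨y, w, e0, e1, e3, e2, ez, hE⟩ := (h x).1
    have l1 := h₁.le_scaled (hr 0) hi y
    have l2 := h₀.le_scaled (hr 1) hd' w
    simp [Fin.sum_univ_four] at hx l1 l2
    rw [e0, e1, e3, ez] at l1
    rw [e2] at l2
    simp only [Matrix.smul_cons, smul_eq_mul, Matrix.smul_empty, mul_neg, mul_one, mul_zero]
      at l2 ⊢
    linarith
  · obtain ⟨y, -, hy⟩ := h₁.exists_scaled (hr 0) hi 0 0
    obtain ⟨w, hw0, hw⟩ := h₀.exists_scaled (hr 1) hd' 0 (y 2)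
    have l1 := (h ![y 0, y 1, w 2, y 3]).2
      ⟨y, w, rfl, rfl, rfl, rfl, hw0.symm, rfl⟩
    have l2 := h₀.le i ![y 0, y 1, w 2, y 3] hi
    simp [Fin.sum_univ_four] at hy hw l2
    rw [hw0] at hw
    simp only [Matrix.smul_cons, smul_eq_mul, Matrix.smul_empty, mul_neg, mul_one, mul_zero]
      at hw ⊢
    linarith

theorem RenormalizesSnd.dual (h : RenormalizesSnd Q₀ Q₁ r) (h₀ : IsConjugate Q₀ P₀)
    (h₁ : IsConjugate Q₁ P₁) (hr : ∀ e, 0 < r e) {i : Fin 4 → ℝ} (hi : ∑ k, i k = 0) :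
    P₁ i = r 5 * P₀ i + r 2 * (i 0 ^ 2 * P₁ ![1, 0, -1, 0]) +
      (r 3 * i 1 ^ 2 + r 4 * i 3 ^ 2) * P₀ ![0, 1, 0, -1] := by
  have hd : ∑ k, (![1, 0, -1, 0] : Fin 4 → ℝ) k = 0 := by simp [Fin.sum_univ_four]
  have hc : ∑ k, (![0, 1, 0, -1] : Fin 4 → ℝ) k = 0 := by simp [Fin.sum_univ_four]
  have hd' : ∑ k, (i 0 • ![1, 0, -1, 0] : Fin 4 → ℝ) k = 0 := by
    simp only [Pi.smul_apply, ← Finset.smul_sum, hd, smul_zero]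
  have hc1 : ∑ k, (i 1 • ![0, 1, 0, -1] : Fin 4 → ℝ) k = 0 := by
    simp only [Pi.smul_apply, ← Finset.smul_sum, hc, smul_zero]
  have hc3 : ∑ k, (-i 3 • ![0, 1, 0, -1] : Fin 4 → ℝ) k = 0 := by
    simp only [Pi.smul_apply, ← Finset.smul_sum, hc, smul_zero]
  have p0 := h₁.smul (i 0) _ hd
  have p1 := h₀.smul (i 1) _ hc
  have p3 := h₀.smul (-i 3) _ hc
  rw [neg_sq] at p3
  apply le_antisymm
  · obtain ⟨x, hx⟩ := h₁.exists_potential i hi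
    obtain ⟨y, α, β, γ, e0, e1, e3, e2, f0, f1, f3, hE⟩ := (h x).1
    have l1 := h₁.le_scaled (hr 2) hd' y
    have l2 := h₀.le_scaled (hr 3) hc1 α
    have l3 := h₀.le_scaled (hr 4) hc3 β
    have l4 := h₀.le_scaled (hr 5) hi γ
    rw [p0] at l1
    rw [p1] at l2
    rw [p3] at l3
    simp [Fin.sum_univ_four] at hx l1 l2 l3 l4
    rw [e0, f0] at l1
    rw [e1, f1] at l2
    rw [e3, f3] at l3
    rw [e2] at l4
    linarith
  · obtain ⟨γ, -, hγ⟩ := h₀.exists_scaled (hr 5) hi 0 0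
    obtain ⟨y, f0, hy⟩ := h₁.exists_scaled (hr 2) hd' 2 (γ 0)
    obtain ⟨α, f1, hα⟩ := h₀.exists_scaled (hr 3) hc1 3 (γ 1)
    obtain ⟨β, f3, hβ⟩ := h₀.exists_scaled (hr 4) hc3 1 (γ 3)
    have l1 := (h ![y 0, α 1, γ 2, β 3]).2
      ⟨y, α, β, γ, rfl, rfl, rfl, rfl, f0, f1, f3, rfl⟩
    have l2 := h₁.le i ![y 0, α 1, γ 2, β 3] hi
    rw [p0] at hy
    rw [p1] at hα
    rw [p3] at hβ
    simp [Fin.sum_univ_four] at hy hα hβ hγ l2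
    rw [f0] at hy
    rw [f1] at hα
    rw [f3] at hβ
    linarith

/-- The solutions of the renormalization equations are traces of star-shaped networks. -/
theorem exists_star_of_renormalizes (hF : RenormalizesFst Q₀ Q₁ r) (hS : RenormalizesSnd Q₀ Q₁ r)
    (h₀ : IsConjugate Q₀ P₀) (h₁ : IsConjugate Q₁ P₁) (hr : ∀ e, 0 < r e) (hlt : r 0 * r 5 < 1) :
    ∃ ρ σ : Fin 4 → ℝ, (∀ k, 0 < ρ k) ∧ (∀ k, 0 < σ k) ∧ Q₀ = starForm ρ ∧ Q₁ = starForm σ := by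
  have hA0 : 0 < P₀ ![-1, 0, 1, 0] := h₀.pos _ (by simp [Fin.sum_univ_four])
    (fun h => by simpa using congrFun h 2)
  have hB0 : 0 < P₀ ![0, 1, 0, -1] := h₀.pos _ (by simp [Fin.sum_univ_four])
    (fun h => by simpa using congrFun h 1)
  have hA1 : 0 < P₁ ![1, 0, -1, 0] := h₁.pos _ (by simp [Fin.sum_univ_four])
    (fun h => by simpa using congrFun h 0)
  have e0 := fun {i : Fin 4 → ℝ} (hi : ∑ k, i k = 0) => hF.dual h₀ h₁ hr hi
  have e1 := fun {i : Fin 4 → ℝ} (hi : ∑ k, i k = 0) => hS.dual h₀ h₁ hr hi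
  generalize P₀ ![-1, 0, 1, 0] = A0 at *
  generalize P₀ ![0, 1, 0, -1] = B0 at *
  generalize P₁ ![1, 0, -1, 0] = A1 at *
  have h5 : 0 < 1 - r 0 * r 5 := by linarith
  have p0 := hr 0
  have p1 := hr 1
  have p2 := hr 2
  have p3 := hr 3
  have p4 := hr 4
  have p5 := hr 5
  let ρ : Fin 4 → ℝ := ![r 0 * r 2 * A1 / (1 - r 0 * r 5), r 0 * r 3 * B0 / (1 - r 0 * r 5),
    r 1 * A0 / (1 - r 0 * r 5), r 0 * r 4 * B0 / (1 - r 0 * r 5)]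
  let σ : Fin 4 → ℝ := ![r 2 * A1 / (1 - r 0 * r 5), r 3 * B0 / (1 - r 0 * r 5),
    r 5 * r 1 * A0 / (1 - r 0 * r 5), r 4 * B0 / (1 - r 0 * r 5)]
  have hρ : ∀ k, 0 < ρ k := by
    intro k; fin_cases k <;> simp [ρ] <;> positivity
  have hσ : ∀ k, 0 < σ k := by
    intro k; fin_cases k <;> simp [σ] <;> positivity
  refine ⟨ρ, σ, hρ, hσ, h₀.form_unique (isConjugate_starForm hρ) fun i hi => ?_,
    h₁.form_unique (isConjugate_starForm hσ) fun i hi => ?_⟩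
  · have a0 := e0 hi
    have a1 := e1 hi
    rw [a1] at a0
    simp [Fin.sum_univ_four, ρ]
    field_simp
    linear_combination a0
  · have a0 := e0 hi
    have a1 := e1 hi
    rw [a0] at a1
    simp [Fin.sum_univ_four, σ]
    field_simp
    linear_combination a1

/-- The parameters of a normalized solution. -/
theorem factors_of_renormalizes {ρ σ : Fin 4 → ℝ} (hρ : ∀ k, 0 < ρ k) (hσ : ∀ k, 0 < σ k)
    (hρ0 : ρ 0 = 1) (hσ0 : σ 0 = 1) (hF : RenormalizesFst (starForm ρ) (starForm σ) r)
    (hS : RenormalizesSnd (starForm ρ) (starForm σ) r) (hr : ∀ e, 0 < r e) :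
    ∃ a b c d : ℝ, 0 < a ∧ 0 < b ∧ 0 < c ∧ 0 < d ∧ d < b ∧ ρ = ![1, a, b, c] ∧
      σ = ![1, a, d, c] ∧ r = ![1, (b - d) / (1 + b), (b - d) / (b + b * d),
        (a * b - a * d) / (a * b + c * b), (c * b - c * d) / (a * b + c * b), d / b] := by
  have h₀ := isConjugate_starForm hρ
  have h₁ := isConjugate_starForm hσ
  have e0 : ρ = ![r 0 * σ 0, r 0 * σ 1, r 0 * σ 2 + r 1 * (ρ 0 + ρ 2), r 0 * σ 3] := by
    apply eq_of_sum_mul_sq_eq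
    intro i hi
    rw [hF.dual h₀ h₁ hr hi]
    simp [Fin.sum_univ_four]
    ring
  have e1 : σ = ![r 5 * ρ 0 + r 2 * (σ 0 + σ 2), r 5 * ρ 1 + r 3 * (ρ 1 + ρ 3), r 5 * ρ 2,
      r 5 * ρ 3 + r 4 * (ρ 1 + ρ 3)] := by
    apply eq_of_sum_mul_sq_eq
    intro i hi
    rw [hS.dual h₀ h₁ hr hi]
    simp [Fin.sum_univ_four]
    ring
  have a0 : ρ 0 = r 0 * σ 0 := congrFun e0 0
  have a1 : ρ 1 = r 0 * σ 1 := congrFun e0 1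
  have a2 : ρ 2 = r 0 * σ 2 + r 1 * (ρ 0 + ρ 2) := congrFun e0 2
  have a3 : ρ 3 = r 0 * σ 3 := congrFun e0 3
  have b0 : σ 0 = r 5 * ρ 0 + r 2 * (σ 0 + σ 2) := congrFun e1 0
  have b1 : σ 1 = r 5 * ρ 1 + r 3 * (ρ 1 + ρ 3) := congrFun e1 1
  have b2 : σ 2 = r 5 * ρ 2 := congrFun e1 2
  have b3 : σ 3 = r 5 * ρ 3 + r 4 * (ρ 1 + ρ 3) := congrFun e1 3
  clear e0 e1
  have hr0 : r 0 = 1 := by rw [hρ0, hσ0] at a0; linarith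
  rw [hr0, one_mul] at a1 a2 a3
  rw [hρ0] at a2
  rw [hρ0, hσ0] at b0
  rw [← a1] at b1
  rw [← a3] at b3
  have pb := hρ 2
  have pd := hσ 2
  have pa := hρ 1
  have pc := hρ 3
  have h5 : r 5 = σ 2 / ρ 2 := by rw [eq_div_iff pb.ne']; exact b2.symm
  refine ⟨ρ 1, ρ 2, ρ 3, σ 2, pa, pb, pc, pd, ?_, ?_, ?_, ?_⟩
  · have : 0 < r 1 * (1 + ρ 2) := mul_pos (hr 1) (by linarith)
    linarith
  · funext k; fin_cases k <;> simp [hρ0]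
  · funext k; fin_cases k <;> simp [hσ0, a1, a3]
  · funext k
    rw [h5] at b0 b1 b3
    fin_cases k
    · exact hr0
    · change r 1 = (ρ 2 - σ 2) / (1 + ρ 2)
      rw [eq_div_iff (by positivity)]; linarith
    · change r 2 = (ρ 2 - σ 2) / (ρ 2 + ρ 2 * σ 2)
      field_simp at b0 ⊢
      linear_combination -b0
    · change r 3 = (ρ 1 * ρ 2 - ρ 1 * σ 2) / (ρ 1 * ρ 2 + ρ 3 * ρ 2)
      field_simp at b1 ⊢
      linear_combination -b1
    · change r 4 = (ρ 3 * ρ 2 - ρ 3 * σ 2) / (ρ 1 * ρ 2 + ρ 3 * ρ 2)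
      field_simp at b3 ⊢
      linear_combination -b3
    · exact h5

end Vicsek

namespace Vicsek

/-! ### Star-shaped networks that satisfy the renormalization equations -/

section

variable {ρ σ : Fin 4 → ℝ} {r : Fin 6 → ℝ}

theorem exists_star_currents (hρ : ∀ k, 0 < ρ k) (x : Fin 4 → ℝ) :
    ∃ (o : ℝ) (i : Fin 4 → ℝ), ∑ k, i k = 0 ∧ (∀ k, x k = o + ρ k * i k) ∧
      starForm ρ x = ∑ k, ρ k * i k ^ 2 := by
  refine ⟨starMean ρ x, fun k => (x k - starMean ρ x) / ρ k, sum_sub_starMean hρ x, fun k => ?_,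
    Finset.sum_congr rfl fun k _ => ?_⟩
  · have := (hρ k).ne'; field_simp; ring
  · have := (hρ k).ne'; field_simp

theorem inv_mul_starForm_le (hσ : ∀ k, 0 < σ k) {t : ℝ} (ht : 0 < t) {y i : Fin 4 → ℝ} (o : ℝ)
    (hy : ∀ k, y k = o + t * (σ k * i k)) :
    t⁻¹ * starForm σ y ≤ t * ∑ k, σ k * i k ^ 2 := by
  have h : ∑ k, (y k - o) ^ 2 / σ k = t ^ 2 * ∑ k, σ k * i k ^ 2 := by
    rw [Finset.mul_sum]
    refine Finset.sum_congr rfl fun k _ => ?_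
    have := (hσ k).ne'
    rw [hy k]; field_simp; ring
  rw [inv_mul_le_iff₀ ht]
  calc starForm σ y ≤ _ := starForm_le hσ y o
    _ = t * (t * ∑ k, σ k * i k ^ 2) := by rw [h]; ring

theorem renormalizesFst_starForm (hρ : ∀ k, 0 < ρ k) (hσ : ∀ k, 0 < σ k) (hr : ∀ e, 0 < r e)
    (h0 : ρ 0 = r 0 * σ 0) (h1 : ρ 1 = r 0 * σ 1) (h2 : ρ 2 = r 0 * σ 2 + r 1 * (ρ 0 + ρ 2))
    (h3 : ρ 3 = r 0 * σ 3) : RenormalizesFst (starForm ρ) (starForm σ) r := by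
  intro x
  have hd : ∀ t : ℝ, ∑ k, (![-t, 0, t, 0] : Fin 4 → ℝ) k = 0 := fun t => by
    simp [Fin.sum_univ_four]
  obtain ⟨o, i, hi, hx, hE⟩ := exists_star_currents hρ x
  have hlow : starForm ρ x ∈ lowerBounds {t | ∃ y w : Fin 4 → ℝ, y 0 = x 0 ∧ y 1 = x 1 ∧
      y 3 = x 3 ∧ w 2 = x 2 ∧ y 2 = w 0 ∧
      (r 0)⁻¹ * starForm σ y + (r 1)⁻¹ * starForm ρ w = t} := by
    rintro _ ⟨y, w, e0, e1, e3, e2, ez, rfl⟩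
    have l1 := (isConjugate_starForm hσ).le_scaled (hr 0) hi y
    have l2 := (isConjugate_starForm hρ).le_scaled (hr 1) (hd (i 2)) w
    simp [Fin.sum_univ_four] at hi hE l1 l2
    rw [e0, e1, e3, ez, hx, hx, hx] at l1
    rw [e2, hx] at l2
    rw [hE]
    have hi' : o * (i 0 + i 1 + i 2 + i 3) = 0 := by rw [hi, mul_zero]
    have k0 := congrArg (· * i 0 ^ 2) h0
    have k1 := congrArg (· * i 1 ^ 2) h1
    have k2 := congrArg (· * i 2 ^ 2) h2
    have k3 := congrArg (· * i 3 ^ 2) h3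
    linarith
  refine ⟨?_, hlow⟩
  let z : ℝ := o + r 0 * (σ 2 * i 2)
  have hmem : (r 0)⁻¹ * starForm σ ![x 0, x 1, z, x 3] + (r 1)⁻¹ *
      starForm ρ ![z, z + r 1 * (ρ 0 * i 2), x 2, z + r 1 * (ρ 0 * i 2)] ∈
      {t | ∃ y w : Fin 4 → ℝ, y 0 = x 0 ∧ y 1 = x 1 ∧ y 3 = x 3 ∧ w 2 = x 2 ∧ y 2 = w 0 ∧
        (r 0)⁻¹ * starForm σ y + (r 1)⁻¹ * starForm ρ w = t} :=
    ⟨![x 0, x 1, z, x 3], ![z, z + r 1 * (ρ 0 * i 2), x 2, z + r 1 * (ρ 0 * i 2)],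
      rfl, rfl, rfl, rfl, rfl, rfl⟩
  have b1 := inv_mul_starForm_le hσ (hr 0) (y := ![x 0, x 1, z, x 3]) (i := i) o (by
    intro k
    fin_cases k
    · change x 0 = o + r 0 * (σ 0 * i 0); rw [hx, h0]; ring
    · change x 1 = o + r 0 * (σ 1 * i 1); rw [hx, h1]; ring
    · rfl
    · change x 3 = o + r 0 * (σ 3 * i 3); rw [hx, h3]; ring)
  have b2 := inv_mul_starForm_le hρ (hr 1)
    (y := ![z, z + r 1 * (ρ 0 * i 2), x 2, z + r 1 * (ρ 0 * i 2)]) (i := ![-i 2, 0, i 2, 0])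
    (z + r 1 * (ρ 0 * i 2)) (by
    intro k
    fin_cases k
    · simp
    · simp
    · change x 2 = o + r 0 * (σ 2 * i 2) + r 1 * (ρ 0 * i 2) + r 1 * (ρ 2 * i 2)
      rw [hx]; linear_combination i 2 * h2
    · simp)
  have heq := le_antisymm (hlow hmem) (by
    refine (add_le_add b1 b2).trans (le_of_eq ?_)
    rw [hE]
    simp [Fin.sum_univ_four]
    linear_combination (-i 0 ^ 2) * h0 - i 1 ^ 2 * h1 - i 2 ^ 2 * h2 - i 3 ^ 2 * h3)
  rw [heq]
  exact hmem

theorem renormalizesSnd_starForm (hρ : ∀ k, 0 < ρ k) (hσ : ∀ k, 0 < σ k) (hr : ∀ e, 0 < r e)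
    (h0 : σ 0 = r 5 * ρ 0 + r 2 * (σ 0 + σ 2)) (h1 : σ 1 = r 5 * ρ 1 + r 3 * (ρ 1 + ρ 3))
    (h2 : σ 2 = r 5 * ρ 2) (h3 : σ 3 = r 5 * ρ 3 + r 4 * (ρ 1 + ρ 3)) :
    RenormalizesSnd (starForm ρ) (starForm σ) r := by
  intro x
  have hd : ∀ t : ℝ, ∑ k, (![t, 0, -t, 0] : Fin 4 → ℝ) k = 0 := fun t => by
    simp [Fin.sum_univ_four]
  have hc : ∀ t : ℝ, ∑ k, (![0, t, 0, -t] : Fin 4 → ℝ) k = 0 := fun t => by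
    simp [Fin.sum_univ_four]
  obtain ⟨o, i, hi, hx, hE⟩ := exists_star_currents hσ x
  set S : Set ℝ := {t | ∃ y α β γ : Fin 4 → ℝ, y 0 = x 0 ∧ α 1 = x 1 ∧ β 3 = x 3 ∧
    γ 2 = x 2 ∧ y 2 = γ 0 ∧ α 3 = γ 1 ∧ β 1 = γ 3 ∧ (r 2)⁻¹ * starForm σ y +
    (r 3)⁻¹ * starForm ρ α + (r 4)⁻¹ * starForm ρ β + (r 5)⁻¹ * starForm ρ γ = t} with hS
  have hlow : starForm σ x ∈ lowerBounds S := by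
    rintro _ ⟨y, α, β, γ, e0, e1, e3, e2, f0, f1, f3, rfl⟩
    have l1 := (isConjugate_starForm hσ).le_scaled (hr 2) (hd (i 0)) y
    have l2 := (isConjugate_starForm hρ).le_scaled (hr 3) (hc (i 1)) α
    have l3 := (isConjugate_starForm hρ).le_scaled (hr 4) (hc (-i 3)) β
    have l4 := (isConjugate_starForm hρ).le_scaled (hr 5) hi γ
    simp [Fin.sum_univ_four] at hi hE l1 l2 l3 l4
    rw [e0, f0, hx] at l1
    rw [e1, f1, hx] at l2
    rw [e3, f3, hx] at l3
    rw [e2, hx] at l4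
    rw [hE]
    have hi' : o * (i 0 + i 1 + i 2 + i 3) = 0 := by rw [hi, mul_zero]
    have k0 := congrArg (· * i 0 ^ 2) h0
    have k1 := congrArg (· * i 1 ^ 2) h1
    have k2 := congrArg (· * i 2 ^ 2) h2
    have k3 := congrArg (· * i 3 ^ 2) h3
    linarith
  refine ⟨?_, hlow⟩
  let g : Fin 4 → ℝ := fun k => o + r 5 * (ρ k * i k)
  let m₀ : ℝ := g 0 + r 2 * (σ 2 * i 0)
  let m₁ : ℝ := g 1 + r 3 * (ρ 3 * i 1)
  let m₃ : ℝ := g 3 + r 4 * (ρ 1 * i 3)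
  have hmem : (r 2)⁻¹ * starForm σ ![x 0, m₀, g 0, m₀] + (r 3)⁻¹ * starForm ρ ![m₁, x 1, m₁, g 1] +
      (r 4)⁻¹ * starForm ρ ![m₃, g 3, m₃, x 3] + (r 5)⁻¹ * starForm ρ g ∈ S :=
    ⟨![x 0, m₀, g 0, m₀], ![m₁, x 1, m₁, g 1], ![m₃, g 3, m₃, x 3], g, rfl, rfl, rfl,
      by rw [hx, h2]; simp only [g]; ring, rfl, rfl, rfl, rfl⟩
  have b0 := inv_mul_starForm_le hσ (hr 2) (y := ![x 0, m₀, g 0, m₀])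
    (i := ![i 0, 0, -i 0, 0]) m₀ (by
    intro k
    fin_cases k
    · change x 0 = o + r 5 * (ρ 0 * i 0) + r 2 * (σ 2 * i 0) + r 2 * (σ 0 * i 0)
      rw [hx]; linear_combination i 0 * h0
    · simp
    · simp [m₀]
    · simp)
  have b1 := inv_mul_starForm_le hρ (hr 3) (y := ![m₁, x 1, m₁, g 1])
    (i := ![0, i 1, 0, -i 1]) m₁ (by
    intro k
    fin_cases k
    · simp
    · change x 1 = o + r 5 * (ρ 1 * i 1) + r 3 * (ρ 3 * i 1) + r 3 * (ρ 1 * i 1)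
      rw [hx]; linear_combination i 1 * h1
    · simp
    · simp [m₁])
  have b3 := inv_mul_starForm_le hρ (hr 4) (y := ![m₃, g 3, m₃, x 3])
    (i := ![0, -i 3, 0, i 3]) m₃ (by
    intro k
    fin_cases k
    · simp
    · simp [m₃]
    · simp
    · change x 3 = o + r 5 * (ρ 3 * i 3) + r 4 * (ρ 1 * i 3) + r 4 * (ρ 3 * i 3)
      rw [hx]; linear_combination i 3 * h3)
  have b2 := inv_mul_starForm_le hρ (hr 5) (y := g) (i := i) o fun _ => rfl
  have heq := le_antisymm (hlow hmem) (by
    refine (add_le_add (add_le_add (add_le_add b0 b1) b3) b2).trans (le_of_eq ?_)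
    rw [hE]
    simp [Fin.sum_univ_four]
    linear_combination (-i 0 ^ 2) * h0 - i 1 ^ 2 * h1 - i 2 ^ 2 * h2 - i 3 ^ 2 * h3)
  rw [heq]
  exact hmem

end

/-! ### Laplacians on a set of four points -/

section Laplacian

variable {X : Type*} {V : Set X} (e : Fin 4 ≃ V)

theorem finsum_eq_sum_fin (f : V → ℝ) : ∑ᶠ x, f x = ∑ k, f (e k) := by
  have := Fintype.ofEquiv _ e
  rw [finsum_eq_sum_of_fintype, ← e.sum_comp]

theorem apply_eq_sum_entry (H : (V → ℝ) →ₗ[ℝ] (V → ℝ)) (u : V → ℝ) (x : V) :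
    H u x = ∑ k, entry H x (e k) * u (e k) := by
  classical
  have := Fintype.ofEquiv _ e
  have h1 : u = ∑ k, u (e k) • Pi.single (e k) (1 : ℝ) := by
    rw [e.sum_comp (fun y => u y • Pi.single y (1 : ℝ))]
    refine (pi_eq_sum_univ' u).trans (Finset.sum_congr rfl fun y _ => ?_)
    congr 1
  conv_lhs => rw [h1]
  rw [map_sum, Finset.sum_apply]
  refine Finset.sum_congr rfl fun k _ => ?_
  rw [map_smul, Pi.smul_apply, smul_eq_mul, mul_comm, entry]

theorem IsLaplacian.symmetric {H : (V → ℝ) →ₗ[ℝ] (V → ℝ)} (h : IsLaplacian H) (u v : V → ℝ) :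
    ∑ k, u (e k) * H v (e k) = ∑ k, v (e k) * H u (e k) := by
  simp only [apply_eq_sum_entry e H, Finset.mul_sum]
  rw [Finset.sum_comm]
  refine Finset.sum_congr rfl fun k _ => Finset.sum_congr rfl fun l _ => ?_
  rw [h.symm]; ring

theorem IsLaplacian.dirichletEnergy_eq {H : (V → ℝ) →ₗ[ℝ] (V → ℝ)} (h : IsLaplacian H)
    (u : V → ℝ) : dirichletEnergy H u = -∑ k, u (e k) * H u (e k) := by
  have hrow : ∀ k, ∑ l, entry H (e k) (e l) = 0 := by
    intro k
    have h1 := apply_eq_sum_entry e H (fun _ => 1) (e k)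
    rw [(h.ker _).2 ⟨1, rfl⟩] at h1
    simpa using h1.symm
  have hcol : ∀ l, ∑ k, entry H (e k) (e l) = 0 := by
    intro l
    rw [← hrow l]
    exact Finset.sum_congr rfl fun k _ => h.symm _ _
  simp only [dirichletEnergy, finsum_eq_sum_fin e, apply_eq_sum_entry e H u, Finset.mul_sum]
  have h1 : ∀ k l, (1 / 2 : ℝ) * (entry H (e k) (e l) * (u (e k) - u (e l)) ^ 2)
      = (1 / 2) * u (e k) ^ 2 * entry H (e k) (e l) + (1 / 2) * u (e l) ^ 2 * entry H (e k) (e l)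
        - u (e k) * (entry H (e k) (e l) * u (e l)) := fun k l => by ring
  simp only [h1, Finset.sum_add_distrib, Finset.sum_sub_distrib, ← Finset.mul_sum, hrow]
  rw [Finset.sum_comm]
  simp only [← Finset.mul_sum, hcol]
  simp

theorem IsLaplacian.exists_isConjugate {H : (V → ℝ) →ₗ[ℝ] (V → ℝ)} (h : IsLaplacian H) :
    ∃ P, IsConjugate (fun x => dirichletEnergy H (x ∘ e.symm)) P := by
  let T : (Fin 4 → ℝ) →ₗ[ℝ] (Fin 4 → ℝ) :=
    { toFun := fun x k => -H (x ∘ e.symm) (e k)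
      map_add' := fun x y => by
        funext k
        have : (x + y) ∘ e.symm = x ∘ e.symm + y ∘ e.symm := rfl
        rw [this, map_add]; simp; ring
      map_smul' := fun c x => by
        funext k
        have : (c • x) ∘ e.symm = c • (x ∘ e.symm) := rfl
        rw [this, map_smul]; simp }
  have hT : ∀ x k, T x k = -H (x ∘ e.symm) (e k) := fun _ _ => rfl
  have hQ : ∀ x, dirichletEnergy H (x ∘ e.symm) = ∑ k, x k * T x k := by
    intro x
    rw [h.dirichletEnergy_eq e]
    simp [hT]
  simp only [hQ]
  refine Vicsek.exists_isConjugate T ?_ ?_ ?_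
  · intro x y
    have := h.symmetric e (x ∘ e.symm) (y ∘ e.symm)
    simp only [Function.comp_apply, Equiv.symm_apply_apply] at this
    simp only [hT, mul_neg, Finset.sum_neg_distrib, this]
  · intro x
    have := h.nonpos (x ∘ e.symm)
    rw [finsum_eq_sum_fin e] at this
    simp only [Function.comp_apply, Equiv.symm_apply_apply] at this
    simp only [hT, mul_neg, Finset.sum_neg_distrib]
    linarith
  · intro x
    have h1 : T x = 0 ↔ H (x ∘ e.symm) = 0 := by
      constructor
      · intro h0
        funext y
        have := congrFun h0 (e.symm y)
        rw [hT] at this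
        simpa using this
      · intro h0
        funext k
        rw [hT, h0]; simp
    rw [h1, h.ker]
    constructor
    · rintro ⟨c, hc⟩
      exact ⟨c, by funext k; simpa using congrFun hc (e k)⟩
    · rintro ⟨c, rfl⟩
      exact ⟨c, rfl⟩

/-- A Laplacian is determined by its energy. -/
theorem IsLaplacian.eq_of_dirichletEnergy_eq {H H' : (V → ℝ) →ₗ[ℝ] (V → ℝ)} (h : IsLaplacian H)
    (h' : IsLaplacian H') (hE : dirichletEnergy H = dirichletEnergy H')
    (e : Fin 4 ≃ V) : H = H' := by
  classical
  have hpol : ∀ {G : (V → ℝ) →ₗ[ℝ] (V → ℝ)}, IsLaplacian G → ∀ u v : V → ℝ,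
      ∑ k, u (e k) * G v (e k) =
        -(dirichletEnergy G (u + v) - dirichletEnergy G u - dirichletEnergy G v) / 2 := by
    intro G hG u v
    have hs := hG.symmetric e u v
    simp only [hG.dirichletEnergy_eq e, map_add, Pi.add_apply, add_mul, mul_add,
      Finset.sum_add_distrib]
    linarith
  refine LinearMap.ext fun v => funext fun x => ?_
  have h1 := hpol h (Pi.single x 1) v
  rw [hE, ← hpol h' (Pi.single x 1) v] at h1
  obtain ⟨j, rfl⟩ := e.surjective x
  simpa [Pi.single_apply] using h1

/-- The Laplacian of the trace of a star-shaped network. -/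
noncomputable def starLaplacian (ρ : Fin 4 → ℝ) : (V → ℝ) →ₗ[ℝ] (V → ℝ) where
  toFun u x := (starMean ρ (u ∘ e) - u x) / ρ (e.symm x)
  map_add' u v := by
    have : starMean ρ ((u + v) ∘ e) = starMean ρ (u ∘ e) + starMean ρ (v ∘ e) := by
      simp only [starMean, Function.comp_apply, Pi.add_apply, add_div, Finset.sum_add_distrib]
    funext x
    simp only [this, Pi.add_apply]
    ring
  map_smul' c u := by
    have : starMean ρ ((c • u) ∘ e) = c * starMean ρ (u ∘ e) := by
      simp only [starMean, Function.comp_apply, Pi.smul_apply, smul_eq_mul, mul_div_assoc,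
        ← Finset.mul_sum]
    funext x
    simp only [this, Pi.smul_apply, smul_eq_mul, RingHom.id_apply]
    ring

variable {ρ : Fin 4 → ℝ}

theorem sum_mul_starLaplacian (hρ : ∀ k, 0 < ρ k) (u : V → ℝ) :
    ∑ k, u (e k) * starLaplacian e ρ u (e k) = -starForm ρ (u ∘ e) := by
  have h := sum_sub_starMean hρ (u ∘ e)
  set m := starMean ρ (u ∘ e) with hm
  have h1 : ∀ k, u (e k) * starLaplacian e ρ u (e k)
      = -((u (e k) - m) ^ 2 / ρ k) - m * (((u ∘ e) k - m) / ρ k) := by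
    intro k
    change u (e k) * ((starMean ρ (u ∘ e) - u (e k)) / ρ (e.symm (e k))) = _
    rw [e.symm_apply_apply, ← hm]
    simp only [Function.comp_apply]
    ring
  simp only [h1, Finset.sum_sub_distrib, ← Finset.mul_sum, h]
  simp [starForm, ← hm]

theorem isLaplacian_starLaplacian (hρ : ∀ k, 0 < ρ k) : IsLaplacian (starLaplacian e ρ) := by
  have hG := sum_inv_pos hρ
  have hentry : ∀ x y : V, x ≠ y → entry (starLaplacian e ρ) x y
      = (ρ (e.symm x))⁻¹ * (ρ (e.symm y))⁻¹ / ∑ k, (ρ k)⁻¹ := by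
    classical
    intro x y hxy
    have h1 : starMean ρ ((Pi.single y 1 : V → ℝ) ∘ e) = (ρ (e.symm y))⁻¹ / ∑ k, (ρ k)⁻¹ := by
      rw [starMean]
      congr 1
      rw [Finset.sum_eq_single (e.symm y)]
      · simp
      · intro k _ hk
        have : e k ≠ y := fun h => hk (by rw [← h, e.symm_apply_apply])
        simp [this]
      · simp
    have h2 : entry (starLaplacian e ρ) x y
        = (starMean ρ ((Pi.single y 1 : V → ℝ) ∘ e) - (Pi.single y 1 : V → ℝ) x)
          / ρ (e.symm x) := by
      rw [entry, starLaplacian]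
      simp only [LinearMap.coe_mk, AddHom.coe_mk]
    rw [h2, h1, Pi.single_apply, if_neg hxy]
    ring
  refine ⟨?_, ?_, ?_, ?_, ?_⟩
  · have := Finite.of_equiv _ e
    exact V.toFinite
  · intro x y
    by_cases hxy : x = y
    · rw [hxy]
    · rw [hentry x y hxy, hentry y x (Ne.symm hxy), mul_comm (ρ (e.symm x))⁻¹]
  · intro u
    rw [finsum_eq_sum_fin e, sum_mul_starLaplacian e hρ, neg_nonpos]
    exact Finset.sum_nonneg fun k _ => div_nonneg (sq_nonneg _) (hρ k).le
  · intro u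
    constructor
    · intro h
      refine ⟨starMean ρ (u ∘ e), funext fun x => ?_⟩
      have h1 : (starMean ρ (u ∘ e) - u x) / ρ (e.symm x) = 0 := congrFun h x
      have := (div_eq_zero_iff.1 h1).resolve_right (hρ _).ne'
      linarith
    · rintro ⟨c, rfl⟩
      funext x
      change (starMean ρ (fun _ => c) - c) / ρ (e.symm x) = 0
      have : starMean ρ (fun _ => c) = c := by
        rw [starMean, div_eq_iff hG.ne', Finset.mul_sum]
        rfl
      rw [this, sub_self, zero_div]
  · intro x y hxy
    rw [hentry x y hxy]
    have := hρ (e.symm x)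
    have := hρ (e.symm y)
    positivity

theorem dirichletEnergy_starLaplacian (hρ : ∀ k, 0 < ρ k) (u : V → ℝ) :
    dirichletEnergy (starLaplacian e ρ) u = starForm ρ (u ∘ e) := by
  rw [(isLaplacian_starLaplacian e hρ).dirichletEnergy_eq e, sum_mul_starLaplacian e hρ, neg_neg]

end Laplacian

end Vicsek

namespace Vicsek

variable {q : Fin 4 → Plane} {A : Set Plane}

/-! ### The energies as forms in the values at the tips -/

/-- The numbering of the boundary points of an island. -/
noncomputable def tipEquiv (hq : IsSquare q) (hA : IsVicsekSet q A) (s : Fin 2) :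
    Fin 4 ≃ (graph q A).boundary s :=
  (Equiv.ofInjective _ (hq.tips_injective s)).trans (Equiv.setCongr (hA.boundary_eq hq s).symm)

@[simp]
theorem coe_tipEquiv (hq : IsSquare q) (hA : IsVicsekSet q A) (s : Fin 2) (k : Fin 4) :
    (tipEquiv hq hA s k : Plane) = tips q s k := rfl

/-- The energy `E_{D_s}` as a function of the four values at the tips. -/
noncomputable def tipForm (hq : IsSquare q) (hA : IsVicsekSet q A) (h : (graph q A).Pair)
    (s : Fin 2) (x : Fin 4 → ℝ) : ℝ :=
  dirichletEnergy (h.D s) (x ∘ (tipEquiv hq hA s).symm)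

/-- Values at the tips of the cells that match at the junctions come from a function. -/
theorem exists_glue (hq : IsSquare q) (hA : IsVicsekSet q A) (U : Fin 6 → Fin 4 → ℝ)
    (h01 : U 0 2 = U 1 0)
    (h25 : U 2 2 = U 5 0) (h35 : U 3 3 = U 5 1) (h45 : U 4 1 = U 5 3) (s : Fin 2) :
    ∃ u : Plane → ℝ, ∀ e, (graph q A).init e = s → ∀ k,
      u ((graph q A).ψ e (tips q ((graph q A).fin e) k)) = U e k := by
  have hlt : ∀ e e' k k', e < e' → (graph q A).init e = (graph q A).init e' →
      (graph q A).ψ e (tips q ((graph q A).fin e) k)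
        = (graph q A).ψ e' (tips q ((graph q A).fin e') k') → U e k = U e' k' := by
    intro e e' k k' hlt hi hee
    rcases hA.coincidence hq hlt hi (hA.tips_mem hq _ k) (hA.tips_mem hq _ k') hee with
      ⟨rfl, rfl, h1, h2⟩ | ⟨rfl, rfl, h1, h2⟩ | ⟨rfl, rfl, h1, h2⟩ | ⟨rfl, rfl, h1, h2⟩
    · obtain rfl := hq.tips_injective 1 (show tips q 1 k = tips q 1 2 from h1)
      obtain rfl := hq.tips_injective 0 (show tips q 0 k' = tips q 0 0 from h2)
      exact h01
    · obtain rfl := hq.tips_injective 1 (show tips q 1 k = tips q 1 2 from h1)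
      obtain rfl := hq.tips_injective 0 (show tips q 0 k' = tips q 0 0 from h2)
      exact h25
    · obtain rfl := hq.tips_injective 0 (show tips q 0 k = tips q 0 3 from h1)
      obtain rfl := hq.tips_injective 0 (show tips q 0 k' = tips q 0 1 from h2)
      exact h35
    · obtain rfl := hq.tips_injective 0 (show tips q 0 k = tips q 0 1 from h1)
      obtain rfl := hq.tips_injective 0 (show tips q 0 k' = tips q 0 3 from h2)
      exact h45
  let pos : {e // (graph q A).init e = s} × Fin 4 → Plane := fun a =>
    (graph q A).ψ a.1 (tips q ((graph q A).fin a.1) a.2)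
  let val : {e // (graph q A).init e = s} × Fin 4 → ℝ := fun a => U a.1 a.2
  have hfac : val.FactorsThrough pos := by
    rintro ⟨⟨e, he⟩, k⟩ ⟨⟨e', he'⟩, k'⟩ hee
    rcases lt_trichotomy e e' with hl | rfl | hl
    · exact hlt e e' k k' hl (he.trans he'.symm) hee
    · obtain rfl := hq.tips_injective _ (graph_ψ_injective q A e hee)
      rfl
    · exact (hlt e' e k' k hl (he'.trans he.symm) hee.symm).symm
  exact ⟨Function.extend pos val 0, fun e he k => hfac.extend_apply 0 ⟨⟨e, he⟩, k⟩⟩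

theorem eqOn_boundary_iff (hq : IsSquare q) (hA : IsVicsekSet q A) (s : Fin 2)
    (u v : Plane → ℝ) :
    EqOn u v ((graph q A).boundary s) ↔ ∀ k, u (tips q s k) = v (tips q s k) := by
  rw [hA.boundary_eq hq, eqOn_range, funext_iff]
  rfl

theorem exists_extend_tips (hq : IsSquare q) (s : Fin 2) (x : Fin 4 → ℝ) :
    ∃ v : Plane → ℝ, v ∘ tips q s = x :=
  ⟨Function.extend (tips q s) x 0, Function.extend_comp (hq.tips_injective s) x 0⟩

section TipForm

variable (hq : IsSquare q) (hA : IsVicsekSet q A) (h : (graph q A).Pair)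

theorem level_zero (s : Fin 2) (u : Plane → ℝ) :
    h.level 0 s u = tipForm hq hA h s (u ∘ tips q s) := by
  rw [tipForm, GraphDirected.Pair.level]
  congr 1
  funext x
  obtain ⟨k, rfl⟩ := (tipEquiv hq hA s).surjective x
  simp

theorem level_one_fst (u : Plane → ℝ) :
    h.level 1 0 u = (h.r 0)⁻¹ * tipForm hq hA h 1 (u ∘ tips q 1) +
      (h.r 1)⁻¹ * tipForm hq hA h 0 (u ∘ F q 2 ∘ tips q 0) := by
  rw [GraphDirected.Pair.level]
  simp only [level_zero hq hA]
  rw [Finset.sum_filter, Fin.sum_univ_six]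
  simp [graph, Function.comp_assoc]

theorem level_one_snd (u : Plane → ℝ) :
    h.level 1 1 u = (h.r 2)⁻¹ * tipForm hq hA h 1 (u ∘ F q 0 ∘ tips q 1) +
      (h.r 3)⁻¹ * tipForm hq hA h 0 (u ∘ F q 1 ∘ tips q 0) +
      (h.r 4)⁻¹ * tipForm hq hA h 0 (u ∘ F q 3 ∘ tips q 0) +
      (h.r 5)⁻¹ * tipForm hq hA h 0 (u ∘ F q 4 ∘ tips q 0) := by
  rw [GraphDirected.Pair.level]
  simp only [level_zero hq hA]
  rw [Finset.sum_filter, Fin.sum_univ_six]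
  simp [graph, Function.comp_assoc]

theorem isTrace_fst_iff :
    IsTrace ((graph q A).boundary 0) (h.level 0 0) (h.level 1 0) ↔
      RenormalizesFst (tipForm hq hA h 0) (tipForm hq hA h 1) h.r := by
  have hF2 : F q 2 (q 2) = q 2 := by rw [F_two]; module
  have hset : ∀ v : Plane → ℝ,
      {t | ∃ u : Plane → ℝ, EqOn u v ((graph q A).boundary 0) ∧ h.level 1 0 u = t} =
      {t | ∃ y w : Fin 4 → ℝ, y 0 = (v ∘ tips q 0) 0 ∧ y 1 = (v ∘ tips q 0) 1 ∧
        y 3 = (v ∘ tips q 0) 3 ∧ w 2 = (v ∘ tips q 0) 2 ∧ y 2 = w 0 ∧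
        (h.r 0)⁻¹ * tipForm hq hA h 1 y + (h.r 1)⁻¹ * tipForm hq hA h 0 w = t} := by
    intro v
    ext t
    simp only [mem_ofPred_eq, eqOn_boundary_iff hq hA, level_one_fst hq hA]
    constructor
    · rintro ⟨u, hu, rfl⟩
      refine ⟨_, _, hu 0, hu 1, hu 3, ?_, rfl, rfl⟩
      change u (F q 2 (q 2)) = _
      rw [hF2]
      exact hu 2
    · rintro ⟨y, w, e0, e1, e3, e2, ez, rfl⟩
      obtain ⟨u, hu⟩ := exists_glue hq hA ![y, w, 0, 0, 0, 0] ez rfl rfl rfl 0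
      have h0 : u ∘ tips q 1 = y := funext fun k => hu 0 rfl k
      have h1 : u ∘ F q 2 ∘ tips q 0 = w := funext fun k => hu 1 rfl k
      refine ⟨u, fun k => ?_, by rw [h0, h1]⟩
      fin_cases k
      · exact (congrFun h0 0).trans e0
      · exact (congrFun h0 1).trans e1
      · refine Eq.trans ?_ ((congrFun h1 2).trans e2)
        change u (q 2) = u (F q 2 (q 2))
        rw [hF2]
      · exact (congrFun h0 3).trans e3
  simp only [IsTrace, hset, level_zero hq hA]
  constructor
  · intro H x
    obtain ⟨v, rfl⟩ := exists_extend_tips hq 0 x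
    exact H v
  · intro H v
    exact H _

theorem isTrace_snd_iff :
    IsTrace ((graph q A).boundary 1) (h.level 0 1) (h.level 1 1) ↔
      RenormalizesSnd (tipForm hq hA h 0) (tipForm hq hA h 1) h.r := by
  obtain ⟨j0, j1, j3, j2⟩ := hq.junctions
  have f0 : F q 0 (q 0) = q 0 := by rw [F_zero]; module
  have f1 : F q 1 (q 1) = q 1 := by rw [F_one]; module
  have f3 : F q 3 (q 3) = q 3 := by rw [F_three]; module
  have hset : ∀ v : Plane → ℝ,
      {t | ∃ u : Plane → ℝ, EqOn u v ((graph q A).boundary 1) ∧ h.level 1 1 u = t} =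
      {t | ∃ y α β γ : Fin 4 → ℝ, y 0 = (v ∘ tips q 1) 0 ∧ α 1 = (v ∘ tips q 1) 1 ∧
        β 3 = (v ∘ tips q 1) 3 ∧ γ 2 = (v ∘ tips q 1) 2 ∧ y 2 = γ 0 ∧ α 3 = γ 1 ∧ β 1 = γ 3 ∧
        (h.r 2)⁻¹ * tipForm hq hA h 1 y + (h.r 3)⁻¹ * tipForm hq hA h 0 α +
        (h.r 4)⁻¹ * tipForm hq hA h 0 β + (h.r 5)⁻¹ * tipForm hq hA h 0 γ = t} := by
    intro v
    ext t
    simp only [mem_ofPred_eq, eqOn_boundary_iff hq hA, level_one_snd hq hA]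
    constructor
    · rintro ⟨u, hu, rfl⟩
      refine ⟨_, _, _, _, ?_, ?_, ?_, ?_, ?_, ?_, ?_, rfl⟩
      · change u (F q 0 (q 0)) = _
        rw [f0]; exact hu 0
      · change u (F q 1 (q 1)) = _
        rw [f1]; exact hu 1
      · change u (F q 3 (q 3)) = _
        rw [f3]; exact hu 3
      · change u (F q 4 (q 2)) = _
        rw [j2]; exact hu 2
      · change u (F q 0 (F q 2 (q 0))) = u (F q 4 (q 0))
        rw [j0]
      · change u (F q 1 (q 3)) = u (F q 4 (q 1))
        rw [j1]
      · change u (F q 3 (q 1)) = u (F q 4 (q 3))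
        rw [j3]
    · rintro ⟨y, α, β, γ, e0, e1, e3, e2, g0, g1, g3, rfl⟩
      obtain ⟨u, hu⟩ := exists_glue hq hA ![0, 0, y, α, β, γ] rfl g0 g1 g3 1
      have h2 : u ∘ F q 0 ∘ tips q 1 = y := funext fun k => hu 2 rfl k
      have h3 : u ∘ F q 1 ∘ tips q 0 = α := funext fun k => hu 3 rfl k
      have h4 : u ∘ F q 3 ∘ tips q 0 = β := funext fun k => hu 4 rfl k
      have h5 : u ∘ F q 4 ∘ tips q 0 = γ := funext fun k => hu 5 rfl k
      refine ⟨u, fun k => ?_, by rw [h2, h3, h4, h5]⟩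
      fin_cases k
      · refine Eq.trans ?_ ((congrFun h2 0).trans e0)
        change u (q 0) = u (F q 0 (q 0))
        rw [f0]
      · refine Eq.trans ?_ ((congrFun h3 1).trans e1)
        change u (q 1) = u (F q 1 (q 1))
        rw [f1]
      · refine Eq.trans ?_ ((congrFun h5 2).trans e2)
        change u (F q 2 (q 0)) = u (F q 4 (q 2))
        rw [j2]
      · refine Eq.trans ?_ ((congrFun h4 3).trans e3)
        change u (q 3) = u (F q 3 (q 3))
        rw [f3]
  simp only [IsTrace, hset, level_zero hq hA]
  constructor
  · intro H x
    obtain ⟨v, rfl⟩ := exists_extend_tips hq 1 x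
    exact H v
  · intro H v
    exact H _

theorem isStarTrace_iff (s : Fin 2) {ρ : Fin 4 → ℝ} (hρ : ∀ k, 0 < ρ k) :
    IsStarTrace h s ρ ↔ tipForm hq hA h s = starForm ρ := by
  have key : ∀ v : Plane → ℝ, IsLeast {t | ∃ u : Plane → ℝ,
      EqOn u v ((graph q A).boundary s) ∧ starEnergy (tips q s) (center q) ρ u = t}
      (starForm ρ (v ∘ tips q s)) := by
    intro v
    constructor
    · classical
      have hne : ∀ k, tips q s k ≠ center q := fun k hk => hq.center_notMem_tips s ⟨k, hk⟩
      refine ⟨Function.update v (center q) (starMean ρ (v ∘ tips q s)), ?_, ?_⟩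
      · rw [eqOn_boundary_iff hq hA]
        intro k
        rw [Function.update_of_ne (hne k)]
      · simp only [starEnergy, Function.update_self, Function.update_of_ne (hne _)]
        rfl
    · rintro _ ⟨u, hu, rfl⟩
      rw [eqOn_boundary_iff hq hA] at hu
      refine (starForm_le hρ _ (u (center q))).trans (le_of_eq ?_)
      exact Finset.sum_congr rfl fun k _ => by rw [hu k]; rfl
  simp only [IsStarTrace, IsTrace, level_zero hq hA]
  constructor
  · intro H
    funext x
    obtain ⟨v, rfl⟩ := exists_extend_tips hq s x
    exact (H v).unique (key v)
  · intro H v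
    rw [H]
    exact key v

theorem GraphDirected.Pair.IsHarmonicStructure.exists_isConjugate {h : (graph q A).Pair}
    (hh : h.IsHarmonicStructure) (s : Fin 2) : ∃ P, IsConjugate (tipForm hq hA h s) P :=
  (hh.laplacian s).exists_isConjugate (tipEquiv hq hA s)

theorem GraphDirected.Pair.IsHarmonicStructure.renormalizes {h : (graph q A).Pair}
    (hh : h.IsHarmonicStructure) :
    RenormalizesFst (tipForm hq hA h 0) (tipForm hq hA h 1) h.r ∧
      RenormalizesSnd (tipForm hq hA h 0) (tipForm hq hA h 1) h.r :=
  ⟨(isTrace_fst_iff hq hA h).1 (hh.renormalization 0),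
    (isTrace_snd_iff hq hA h).1 (hh.renormalization 1)⟩

end TipForm

end Vicsek

namespace Vicsek

/-! ### Rescaling -/

section Scaling

variable {X : Type*} {V : Set X}

theorem entry_smul (c : ℝ) (H : (V → ℝ) →ₗ[ℝ] (V → ℝ)) (x y : V) :
    entry (c • H) x y = c * entry H x y := rfl

theorem dirichletEnergy_smul (c : ℝ) (H : (V → ℝ) →ₗ[ℝ] (V → ℝ)) (u : V → ℝ) :
    dirichletEnergy (c • H) u = c * dirichletEnergy H u := by
  have h1 : ∀ x y, entry (c • H) x y * (u x - u y) ^ 2 = c • (entry H x y * (u x - u y) ^ 2) :=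
    fun x y => by rw [entry_smul, smul_eq_mul, mul_assoc]
  simp only [dirichletEnergy, h1, ← smul_finsum]
  rw [smul_eq_mul, mul_left_comm]

theorem IsLaplacian.smul {H : (V → ℝ) →ₗ[ℝ] (V → ℝ)} (h : IsLaplacian H) {c : ℝ} (hc : 0 < c) :
    IsLaplacian (c • H) where
  finite := h.finite
  symm x y := by rw [entry_smul, entry_smul, h.symm]
  nonpos u := by
    have h1 : ∀ x, u x * (c • H) u x = c • (u x * H u x) := fun x => by
      simp only [LinearMap.smul_apply, Pi.smul_apply, smul_eq_mul]; ring
    simp only [h1, ← smul_finsum]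
    exact mul_nonpos_of_nonneg_of_nonpos hc.le (h.nonpos u)
  ker u := by rw [LinearMap.smul_apply, smul_eq_zero_iff_right hc.ne', h.ker]
  offdiag x y hxy := mul_nonneg hc.le (h.offdiag x y hxy)

theorem IsTrace.const_mul {E₁ E₂ : (X → ℝ) → ℝ} (h : IsTrace V E₁ E₂) {c : ℝ} (hc : 0 < c) :
    IsTrace V (fun u => c * E₁ u) (fun u => c * E₂ u) := by
  intro v
  obtain ⟨⟨u, hu, hE⟩, hlow⟩ := h v
  refine ⟨⟨u, hu, by simp only [hE]⟩, ?_⟩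
  rintro _ ⟨u, hu, rfl⟩
  exact mul_le_mul_of_nonneg_left (hlow ⟨u, hu, rfl⟩) hc.le

end Scaling

namespace GraphDirected.Pair

variable {X S E : Type*} {G : GraphDirected X S E} {h : G.Pair} {t : S → ℝ}

theorem rescale_rescale_inv (h : G.Pair) (ht : ∀ s, 0 < t s) : (h.rescale t).rescale t⁻¹ = h := by
  apply Pair.ext
  · funext s
    have := (ht s).ne'
    simp [rescale, smul_smul, this]
  · funext e
    have := (ht (G.fin e)).ne'
    have := (ht (G.init e)).ne'
    simp only [rescale, Pi.inv_apply]
    field_simp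

theorem weight_rescale (h : G.Pair) (ht : ∀ s, 0 < t s) {s : S} {w : List E} (hw : G.IsWalk s w) :
    (h.rescale t).weight w = t (G.endpoint s w) / t s * h.weight w := by
  induction w generalizing s with
  | nil => simp [weight, endpoint, (ht s).ne']
  | cons e w ih =>
    obtain ⟨rfl, hw⟩ := hw
    have h1 := ih hw
    have := (ht (G.fin e)).ne'
    have := (ht (G.init e)).ne'
    simp only [weight, List.map_cons, List.prod_cons, endpoint] at h1 ⊢
    rw [h1]
    simp only [rescale]
    field_simp

theorem IsHomogeneous.rescale [PseudoMetricSpace X] (hh : h.IsHomogeneous) (ht : ∀ s, 0 < t s) :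
    (h.rescale t).IsHomogeneous := by
  intro w w' hw hw' he hd
  rw [weight_rescale h ht hw, weight_rescale h ht hw', he, hh w w' hw hw' he hd]

theorem isHomogeneous_rescale_iff [PseudoMetricSpace X] (ht : ∀ s, 0 < t s) :
    (h.rescale t).IsHomogeneous ↔ h.IsHomogeneous :=
  ⟨fun hh => rescale_rescale_inv h ht ▸ hh.rescale (t := t⁻¹) fun s => inv_pos.2 (ht s),
    fun hh => hh.rescale ht⟩

variable [Fintype E] [DecidableEq S]

theorem level_rescale (h : G.Pair) (ht : ∀ s, 0 < t s) (n : ℕ) (s : S) (u : X → ℝ) :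
    (h.rescale t).level n s u = t s * h.level n s u := by
  induction n generalizing s u with
  | zero => exact dirichletEnergy_smul _ _ _
  | succ n ih =>
    simp only [level, ih, Finset.mul_sum]
    refine Finset.sum_congr rfl fun e he => ?_
    obtain rfl := (Finset.mem_filter.1 he).2
    have := (ht (G.fin e)).ne'
    have := (ht (G.init e)).ne'
    simp only [Pair.rescale, mul_inv, inv_div]
    field_simp

theorem IsRegular.rescale (hh : h.IsRegular) (ht : ∀ s, 0 < t s) : (h.rescale t).IsRegular where
  laplacian s := (hh.laplacian s).smul (ht s)
  pos e := mul_pos (div_pos (ht _) (ht _)) (hh.pos e)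
  renormalization s := by
    have h1 := (hh.renormalization s).const_mul (ht s)
    simpa only [← level_rescale h ht] using h1
  cycle_lt_one s w hne hw he := by
    rw [weight_rescale h ht hw, he, div_self (ht s).ne', one_mul]
    exact hh.cycle_lt_one s w hne hw he

theorem energy_rescale (h : G.Pair) (ht : ∀ s, 0 < t s) (s : S) (u : X → ℝ) :
    (h.rescale t).energy s u = ENNReal.ofReal (t s) * h.energy s u := by
  simp only [energy, level_rescale h ht, ENNReal.ofReal_mul (ht s).le, ENNReal.mul_iSup]

theorem IsInvariantUnder.rescale {g : X → X} (hh : h.IsInvariantUnder g) (ht : ∀ s, 0 < t s) :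
    (h.rescale t).IsInvariantUnder g := by
  intro s u
  rw [energy_rescale h ht, energy_rescale h ht, hh s u]

theorem isRegular_rescale_iff (ht : ∀ s, 0 < t s) : (h.rescale t).IsRegular ↔ h.IsRegular :=
  ⟨fun hh => rescale_rescale_inv h ht ▸ hh.rescale (t := t⁻¹) fun s => inv_pos.2 (ht s),
    fun hh => hh.rescale ht⟩

theorem isInvariantUnder_rescale_iff {g : X → X} (ht : ∀ s, 0 < t s) :
    (h.rescale t).IsInvariantUnder g ↔ h.IsInvariantUnder g :=
  ⟨fun hh => rescale_rescale_inv h ht ▸ hh.rescale (t := t⁻¹) fun s => inv_pos.2 (ht s),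
    fun hh => hh.rescale ht⟩

end GraphDirected.Pair

/-! ### Classification of the regular harmonic structures -/

section Classification

variable {q : Fin 4 → Plane} {A : Set Plane} (hq : IsSquare q) (hA : IsVicsekSet q A)
  {h : (graph q A).Pair}

theorem exists_tipForm_eq_starForm (hh : h.IsRegular) :
    ∃ ρ : Fin 2 → Fin 4 → ℝ, (∀ s k, 0 < ρ s k) ∧ ∀ s, tipForm hq hA h s = starForm (ρ s) := by
  obtain ⟨P₀, h₀⟩ := hh.exists_isConjugate hq hA 0
  obtain ⟨P₁, h₁⟩ := hh.exists_isConjugate hq hA 1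
  obtain ⟨hF, hS⟩ := hh.renormalizes hq hA
  have hlt : h.r 0 * h.r 5 < 1 := by
    have := hh.cycle_lt_one 0 [0, 5] (by simp) ⟨rfl, rfl, trivial⟩ rfl
    simpa [GraphDirected.Pair.weight] using this
  obtain ⟨ρ, σ, hρ, hσ, e0, e1⟩ := exists_star_of_renormalizes hF hS h₀ h₁ hh.pos hlt
  refine ⟨![ρ, σ], fun s => ?_, fun s => ?_⟩ <;> fin_cases s
  exacts [hρ, hσ, e0, e1]

theorem tipForm_rescale (h : (graph q A).Pair) (t : Fin 2 → ℝ) (s : Fin 2) (x : Fin 4 → ℝ) :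
    tipForm hq hA (h.rescale t) s x = t s * tipForm hq hA h s x :=
  dirichletEnergy_smul _ _ _

theorem existsUnique_isNormalized_rescale (hq : IsSquare q) (hA : IsVicsekSet q A)
    (hh : h.IsRegular) :
    ∃! t : Fin 2 → ℝ, (∀ s, 0 < t s) ∧ IsNormalized (h.rescale t) := by
  obtain ⟨ρ, hρ, hform⟩ := exists_tipForm_eq_starForm hq hA hh
  have hscale : ∀ t : Fin 2 → ℝ, (∀ s, 0 < t s) → ∀ s,
      tipForm hq hA (h.rescale t) s = starForm fun k => ρ s k / t s := by
    intro t ht s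
    funext x
    rw [tipForm_rescale, hform, starForm_div _ _ (ht s)]
  refine ⟨fun s => ρ s 0, ⟨fun s => hρ s 0, fun s => ?_⟩, ?_⟩
  · have hpos : ∀ k, 0 < ρ s k / ρ s 0 := fun k => div_pos (hρ s k) (hρ s 0)
    refine ⟨fun k => ρ s k / ρ s 0, hpos, div_self (hρ s 0).ne', ?_⟩
    rw [isStarTrace_iff hq hA _ s hpos]
    exact hscale (fun s => ρ s 0) (fun s => hρ s 0) s
  · rintro t ⟨ht, hn⟩
    funext s
    obtain ⟨σ, hσ, hσ0, htr⟩ := hn s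
    rw [isStarTrace_iff hq hA _ s hσ, hscale t ht s] at htr
    have h1 := congrFun (starForm_injective (fun k => div_pos (hρ s k) (ht s)) hσ htr) 0
    rw [hσ0, div_eq_one_iff_eq (ht s).ne'] at h1
    exact h1.symm

theorem exists_isSolution (hq : IsSquare q) (hA : IsVicsekSet q A)
    (hh : h.IsRegular) (hn : IsNormalized h) :
    ∃ a b c d : ℝ, 0 < a ∧ 0 < b ∧ 0 < c ∧ 0 < d ∧ d < b ∧ IsSolution a b c d h := by
  obtain ⟨ρ, hρ, hρ0, h0⟩ := hn 0
  obtain ⟨σ, hσ, hσ0, h1⟩ := hn 1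
  obtain ⟨hF, hS⟩ := hh.renormalizes hq hA
  rw [(isStarTrace_iff hq hA h 0 hρ).1 h0, (isStarTrace_iff hq hA h 1 hσ).1 h1] at hF hS
  obtain ⟨a, b, c, d, ha, hb, hc, hd, hdb, rfl, rfl, hr⟩ :=
    factors_of_renormalizes hρ hσ hρ0 hσ0 hF hS hh.pos
  exact ⟨a, b, c, d, ha, hb, hc, hd, hdb, h0, h1, hr⟩

theorem pos_star {a b c : ℝ} (ha : 0 < a) (hb : 0 < b) (hc : 0 < c) :
    ∀ k, 0 < (![1, a, b, c] : Fin 4 → ℝ) k := by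
  intro k
  fin_cases k
  exacts [one_pos, ha, hb, hc]

theorem IsSolution.parameters_unique (hq : IsSquare q) (hA : IsVicsekSet q A)
    {a b c d a' b' c' d' : ℝ} (ha : 0 < a) (hb : 0 < b)
    (hc : 0 < c) (hd : 0 < d) (ha' : 0 < a') (hb' : 0 < b') (hc' : 0 < c') (hd' : 0 < d')
    (h1 : IsSolution a b c d h) (h2 : IsSolution a' b' c' d' h) :
    a = a' ∧ b = b' ∧ c = c' ∧ d = d' := by
  have e0 := starForm_injective (pos_star ha hb hc) (pos_star ha' hb' hc')
    (((isStarTrace_iff hq hA h 0 (pos_star ha hb hc)).1 h1.star_one).symm.trans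
      ((isStarTrace_iff hq hA h 0 (pos_star ha' hb' hc')).1 h2.star_one))
  have e1 := starForm_injective (pos_star ha hd hc) (pos_star ha' hd' hc')
    (((isStarTrace_iff hq hA h 1 (pos_star ha hd hc)).1 h1.star_two).symm.trans
      ((isStarTrace_iff hq hA h 1 (pos_star ha' hd' hc')).1 h2.star_two))
  exact ⟨congrFun e0 1, congrFun e0 2, congrFun e0 3, congrFun e1 2⟩

theorem IsSolution.structure_unique (hq : IsSquare q) (hA : IsVicsekSet q A)
    {h' : (graph q A).Pair} {a b c d : ℝ} (ha : 0 < a)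
    (hb : 0 < b) (hc : 0 < c) (hd : 0 < d) (hh : h.IsHarmonicStructure)
    (hh' : h'.IsHarmonicStructure) (h1 : IsSolution a b c d h) (h2 : IsSolution a b c d h') :
    h = h' := by
  apply GraphDirected.Pair.ext
  · funext s
    have hform : tipForm hq hA h s = tipForm hq hA h' s := by
      fin_cases s
      · exact ((isStarTrace_iff hq hA h 0 (pos_star ha hb hc)).1 h1.star_one).trans
          ((isStarTrace_iff hq hA h' 0 (pos_star ha hb hc)).1 h2.star_one).symm
      · exact ((isStarTrace_iff hq hA h 1 (pos_star ha hd hc)).1 h1.star_two).trans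
          ((isStarTrace_iff hq hA h' 1 (pos_star ha hd hc)).1 h2.star_two).symm
    refine (hh.laplacian s).eq_of_dirichletEnergy_eq (hh'.laplacian s) (funext fun u => ?_)
      (tipEquiv hq hA s)
    have := congrFun hform (u ∘ tipEquiv hq hA s)
    simpa [tipForm, Function.comp_assoc] using this
  · rw [h1.factors, h2.factors]

/-- The harmonic structure with parameters `a, b, c, d`. -/
noncomputable def solutionPair (a b c d : ℝ) : (graph q A).Pair where
  D s := starLaplacian (tipEquiv hq hA s) ((![![1, a, b, c], ![1, a, d, c]] : Fin 2 → _) s)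
  r := ![1, (b - d) / (1 + b), (b - d) / (b + b * d),
    (a * b - a * d) / (a * b + c * b), (c * b - c * d) / (a * b + c * b), d / b]

variable {a b c d : ℝ}

theorem isSolution_solutionPair (ha : 0 < a) (hb : 0 < b) (hc : 0 < c) (hd : 0 < d) :
    IsSolution a b c d (solutionPair hq hA a b c d) where
  star_one := by
    rw [isStarTrace_iff hq hA _ 0 (pos_star ha hb hc)]
    funext x
    refine (dirichletEnergy_starLaplacian (tipEquiv hq hA 0) (pos_star ha hb hc) _).trans ?_
    simp [Function.comp_assoc]
  star_two := by
    rw [isStarTrace_iff hq hA _ 1 (pos_star ha hd hc)]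
    funext x
    refine (dirichletEnergy_starLaplacian (tipEquiv hq hA 1) (pos_star ha hd hc) _).trans ?_
    simp [Function.comp_assoc]
  factors := rfl

/-- All factors but the first are smaller than one. -/
theorem IsSolution.factor_bounds (hs : IsSolution a b c d h) (ha : 0 < a) (hc : 0 < c)
    (hd : 0 < d) (hdb : d < b) : (∀ e, 0 < h.r e) ∧ h.r 0 = 1 ∧ ∀ e, e ≠ 0 → h.r e < 1 := by
  have hb : 0 < b := hd.trans hdb
  have hbd : 0 < b - d := sub_pos.2 hdb
  have e1 : a * b - a * d = a * (b - d) := by ring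
  have e2 : c * b - c * d = c * (b - d) := by ring
  rw [hs.factors]
  refine ⟨fun e => ?_, rfl, fun e he => ?_⟩
  · fin_cases e <;> simp [e1, e2] <;> positivity
  · fin_cases e
    · exact absurd rfl he
    · change (b - d) / (1 + b) < 1
      rw [div_lt_one (by positivity)]; linarith
    · change (b - d) / (b + b * d) < 1
      rw [div_lt_one (by positivity)]; nlinarith [mul_pos hb hd]
    · change (a * b - a * d) / (a * b + c * b) < 1
      rw [div_lt_one (by positivity)]; nlinarith [mul_pos ha hd, mul_pos hc hb]
    · change (c * b - c * d) / (a * b + c * b) < 1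
      rw [div_lt_one (by positivity)]; nlinarith [mul_pos hc hd, mul_pos ha hb]
    · change d / b < 1
      rwa [div_lt_one hb]

theorem weight_le_one (hpos : ∀ e, 0 < h.r e) (hle : ∀ e, h.r e ≤ 1) (w : List (Fin 6)) :
    0 < h.weight w ∧ h.weight w ≤ 1 := by
  induction w with
  | nil => simp [GraphDirected.Pair.weight]
  | cons e w ih =>
    have : h.weight (e :: w) = h.r e * h.weight w := rfl
    rw [this]
    exact ⟨mul_pos (hpos e) ih.1, mul_le_one₀ (hle e) ih.1.le ih.2⟩

theorem weight_lt_one_of_cycle (hpos : ∀ e, 0 < h.r e) (h0 : h.r 0 = 1)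
    (hlt : ∀ e, e ≠ 0 → h.r e < 1) {s : Fin 2} {w : List (Fin 6)} (hne : w ≠ [])
    (hw : (graph q A).IsWalk s w) (he : (graph q A).endpoint s w = s) : h.weight w < 1 := by
  have hle : ∀ e, h.r e ≤ 1 := fun e => by
    by_cases h1 : e = 0
    · rw [h1, h0]
    · exact (hlt e h1).le
  match w, hne with
  | e :: w, _ =>
    obtain ⟨rfl, hw⟩ := hw
    have hwt : h.weight (e :: w) = h.r e * h.weight w := rfl
    have hb := weight_le_one hpos hle w
    by_cases h1 : e = 0
    · subst h1
      rw [hwt, h0, one_mul]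
      match w with
      | [] => exact absurd (show (1 : Fin 2) = 0 from he) (by decide)
      | e' :: w =>
        have hi : (graph q A).init e' = 1 := hw.1
        have hne : e' ≠ 0 := by
          rintro rfl
          exact absurd (show (0 : Fin 2) = 1 from hi) (by decide)
        have hwt : h.weight (e' :: w) = h.r e' * h.weight w := rfl
        have hb := weight_le_one hpos hle w
        rw [hwt]
        exact (mul_le_of_le_one_right (hpos e').le hb.2).trans_lt (hlt e' hne)
    · rw [hwt]
      exact (mul_le_of_le_one_right (hpos e).le hb.2).trans_lt (hlt e h1)

theorem isRegular_solutionPair (ha : 0 < a) (hc : 0 < c) (hd : 0 < d) (hdb : d < b) :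
    (solutionPair hq hA a b c d).IsRegular := by
  have hb : 0 < b := hd.trans hdb
  have hs := isSolution_solutionPair hq hA ha hb hc hd
  obtain ⟨hpos, h0, hlt⟩ := hs.factor_bounds ha hc hd hdb
  have hρ := pos_star ha hb hc
  have hσ := pos_star ha hd hc
  refine ⟨⟨fun s => ?_, hpos, fun s => ?_⟩, fun s w hne hw he =>
    weight_lt_one_of_cycle hpos h0 hlt hne hw he⟩
  · refine isLaplacian_starLaplacian _ ?_
    fin_cases s
    exacts [hρ, hσ]
  · have e0 := (isStarTrace_iff hq hA _ 0 hρ).1 hs.star_one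
    have e1 := (isStarTrace_iff hq hA _ 1 hσ).1 hs.star_two
    fin_cases s
    · refine (isTrace_fst_iff hq hA _).2 ?_
      rw [e0, e1]
      refine renormalizesFst_starForm hρ hσ hpos ?_ ?_ ?_ ?_ <;> rw [hs.factors] <;> simp
      field_simp
      ring
    · refine (isTrace_snd_iff hq hA _).2 ?_
      rw [e0, e1]
      refine renormalizesSnd_starForm hρ hσ hpos ?_ ?_ ?_ ?_ <;> rw [hs.factors] <;> simp <;>
        field_simp <;> ring

theorem IsSolution.isNormalized (hs : IsSolution a b c d h) (ha : 0 < a) (hb : 0 < b)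
    (hc : 0 < c) (hd : 0 < d) : IsNormalized h := by
  intro s
  fin_cases s
  · exact ⟨_, pos_star ha hb hc, rfl, hs.star_one⟩
  · exact ⟨_, pos_star ha hd hc, rfl, hs.star_two⟩

end Classification

end Vicsek

namespace Vicsek

variable {q : Fin 4 → Plane} {A : Set Plane}

/-! ### The reflection in the diagonal -/

theorem diagonalReflection_combo (q : Fin 4 → Plane) (s t : ℝ) (hst : s + t = 1) (x y : Plane) :
    diagonalReflection q (s • x + t • y)
      = s • diagonalReflection q x + t • diagonalReflection q y := by
  obtain rfl : s = 1 - t := by linarith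
  rw [← AffineMap.lineMap_apply_module, ← AffineMap.lineMap_apply_module]
  exact (EuclideanGeometry.reflection
    (AffineSubspace.mk' (q 0) (Submodule.span ℝ {q 2 - q 0}))).toAffineMap.apply_lineMap x y t

theorem diagonalReflection_involutive (q : Fin 4 → Plane) :
    Function.Involutive (diagonalReflection q) :=
  EuclideanGeometry.reflection_involutive _

theorem diagonalReflection_zero (q : Fin 4 → Plane) : diagonalReflection q (q 0) = q 0 :=
  (EuclideanGeometry.reflection_eq_self_iff _).2 (AffineSubspace.self_mem_mk' _ _)

theorem diagonalReflection_two (q : Fin 4 → Plane) : diagonalReflection q (q 2) = q 2 := by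
  refine (EuclideanGeometry.reflection_eq_self_iff _).2 ?_
  rw [AffineSubspace.mem_mk']
  exact Submodule.mem_span_singleton_self _

theorem diagonalReflection_center (q : Fin 4 → Plane) :
    diagonalReflection q (center q) = center q := by
  rw [IsSquare.center_eq, diagonalReflection_combo q _ _ (by norm_num), diagonalReflection_zero,
    diagonalReflection_two]

theorem diagonalReflection_one (hq : IsSquare q) : diagonalReflection q (q 1) = q 3 := by
  have h2 : q 2 = q 1 + q 3 - q 0 := by
    rw [← sub_add_cancel (q 2) (q 0), hq.fourth]; module
  have hc : center q = (1 / 2 : ℝ) • (q 1 + q 3) := by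
    rw [IsSquare.center_eq, h2]; module
  have hmem : center q ∈ AffineSubspace.mk' (q 0) (Submodule.span ℝ {q 2 - q 0}) := by
    refine (EuclideanGeometry.reflection_eq_self_iff _).1 (diagonalReflection_center q)
  have hv : q 1 - center q ∈
      (AffineSubspace.mk' (q 0) (Submodule.span ℝ {q 2 - q 0})).directionᗮ := by
    rw [AffineSubspace.direction_mk', Submodule.mem_orthogonal_singleton_iff_inner_right,
      hq.fourth]
    have h1 : q 1 - center q = (1 / 2 : ℝ) • ((q 1 - q 0) - (q 3 - q 0)) := by
      rw [hc]; module
    rw [h1, inner_smul_right, real_inner_add_sub_eq_zero_iff _ _ |>.2 hq.norm_eq, mul_zero]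
  have h := EuclideanGeometry.reflection_orthogonal_vadd hmem hv
  rw [vadd_eq_add, vadd_eq_add, sub_add_cancel] at h
  rw [diagonalReflection, h, hc]
  module

theorem diagonalReflection_three (hq : IsSquare q) : diagonalReflection q (q 3) = q 1 := by
  rw [← diagonalReflection_one hq, diagonalReflection_involutive q]

theorem diagonalReflection_F (hq : IsSquare q) (x : Plane) :
    diagonalReflection q (F q 0 x) = F q 0 (diagonalReflection q x) ∧
    diagonalReflection q (F q 1 x) = F q 3 (diagonalReflection q x) ∧
    diagonalReflection q (F q 2 x) = F q 2 (diagonalReflection q x) ∧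
    diagonalReflection q (F q 3 x) = F q 1 (diagonalReflection q x) ∧
    diagonalReflection q (F q 4 x) = F q 4 (diagonalReflection q x) := by
  simp only [F_zero, F_one, F_two, F_three, F_four]
  refine ⟨?_, ?_, ?_, ?_, ?_⟩ <;> rw [diagonalReflection_combo q _ _ (by norm_num)]
  · rw [diagonalReflection_zero]
  · rw [diagonalReflection_one hq]
  · rw [diagonalReflection_two]
  · rw [diagonalReflection_three hq]
  · rw [diagonalReflection_center]

theorem diagonalReflection_tips (hq : IsSquare q) (s : Fin 2) (k : Fin 4) :
    diagonalReflection q (tips q s k) = tips q s (Equiv.swap 1 3 k) := by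
  have h0 : tips q s 0 = q 0 := by fin_cases s <;> rfl
  have h1 : tips q s 1 = q 1 := by fin_cases s <;> rfl
  have h3 : tips q s 3 = q 3 := by fin_cases s <;> rfl
  fin_cases k
  · change diagonalReflection q (tips q s 0) = tips q s 0
    rw [h0, diagonalReflection_zero]
  · change diagonalReflection q (tips q s 1) = tips q s 3
    rw [h1, h3, diagonalReflection_one hq]
  · change diagonalReflection q (tips q s 2) = tips q s 2
    fin_cases s
    · exact diagonalReflection_two q
    · exact (diagonalReflection_F hq (q 0)).2.2.1.trans (by rw [diagonalReflection_zero]; rfl)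
  · change diagonalReflection q (tips q s 3) = tips q s 1
    rw [h1, h3, diagonalReflection_three hq]

theorem starForm_comp_equiv (ρ x : Fin 4 → ℝ) (τ : Equiv.Perm (Fin 4)) :
    starForm (ρ ∘ τ) (x ∘ τ) = starForm ρ x := by
  have hm : starMean (ρ ∘ τ) (x ∘ τ) = starMean ρ x :=
    congrArg₂ (· / ·) (Equiv.sum_comp τ fun k => x k / ρ k) (Equiv.sum_comp τ fun k => (ρ k)⁻¹)
  rw [starForm, hm]
  exact Equiv.sum_comp τ fun k => (x k - starMean ρ x) ^ 2 / ρ k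

theorem star_comp_swap (a b c : ℝ) :
    (![1, a, b, c] : Fin 4 → ℝ) ∘ Equiv.swap (1 : Fin 4) 3 = ![1, c, b, a] := by
  funext k
  fin_cases k <;> rfl

/-! ### Harmonic extension -/

section HarmonicExtension

/-- The values of the harmonic extension on the island with address `w`, where `m` provides the
harmonic extension to the next level. -/
noncomputable def extensionAlong (q : Fin 4 → Plane) (A : Set Plane)
    (m : Fin 2 → (Plane → ℝ) → Plane → ℝ) :
    Fin 2 → List (Fin 6) → (Plane → ℝ) → Plane → ℝ
  | _, [], v => v
  | s, e :: w, v => extensionAlong q A m ((graph q A).fin e) w (m s v ∘ (graph q A).ψ e)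

variable {m : Fin 2 → (Plane → ℝ) → Plane → ℝ}

theorem extensionAlong_of_map_mem_tips (hq : IsSquare q) (hA : IsVicsekSet q A)
    (hm : ∀ s v, EqOn (m s v) v (range (tips q s))) {s : Fin 2} {w : List (Fin 6)}
    (hw : (graph q A).IsWalk s w) {v : Plane → ℝ} {y : Plane}
    (hy : y ∈ range (tips q ((graph q A).endpoint s w)))
    (h : (graph q A).map w y ∈ range (tips q s)) :
    extensionAlong q A m s w v y = v ((graph q A).map w y) := by
  induction w generalizing s v with
  | nil => rfl
  | cons e w ih =>
    obtain ⟨rfl, hw⟩ := hw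
    have hyK : y ∈ (graph q A).K ((graph q A).endpoint ((graph q A).fin e) w) := by
      obtain ⟨k, rfl⟩ := hy
      exact hA.tips_mem hq _ k
    have hz := hA.mem_tips_of_ψ_mem hq e (hA.map_mem hw hyK) h
    exact (ih hw hy hz).trans (hm _ v h)

/-- The values of the harmonic extension do not depend on the address. -/
theorem extensionAlong_eq (hq : IsSquare q) (hA : IsVicsekSet q A)
    (hm : ∀ s v, EqOn (m s v) v (range (tips q s))) {s : Fin 2} {w w' : List (Fin 6)}
    (hw : (graph q A).IsWalk s w) (hw' : (graph q A).IsWalk s w') {v : Plane → ℝ} {y y' : Plane}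
    (hy : y ∈ range (tips q ((graph q A).endpoint s w)))
    (hy' : y' ∈ range (tips q ((graph q A).endpoint s w')))
    (h : (graph q A).map w y = (graph q A).map w' y') :
    extensionAlong q A m s w v y = extensionAlong q A m s w' v y' := by
  have hK : ∀ {s y}, y ∈ range (tips q s) → y ∈ (graph q A).K s := by
    rintro s _ ⟨k, rfl⟩
    exact hA.tips_mem hq _ k
  induction w generalizing s v w' with
  | nil =>
    have h1 : (graph q A).map w' y' ∈ range (tips q s) := h ▸ hy
    rw [extensionAlong_of_map_mem_tips hq hA hm hw' hy' h1, ← h]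
    rfl
  | cons e w ih =>
    match w' with
    | [] =>
      have h1 : (graph q A).map (e :: w) y ∈ range (tips q s) := h ▸ hy'
      rw [extensionAlong_of_map_mem_tips hq hA hm hw hy h1, h]
      rfl
    | e' :: w' =>
      obtain ⟨rfl, hw⟩ := hw
      obtain ⟨hi, hw'⟩ := hw'
      by_cases hee : e = e'
      · subst hee
        exact ih hw hw' hy hy' (graph_ψ_injective q A e h)
      · have hz := hA.mem_tips_of_coincidence hq hee hi.symm (hA.map_mem hw (hK hy))
          (hA.map_mem hw' (hK hy')) h
        have hz' := hA.mem_tips_of_coincidence hq (Ne.symm hee) hi (hA.map_mem hw' (hK hy'))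
          (hA.map_mem hw (hK hy)) h.symm
        refine (extensionAlong_of_map_mem_tips hq hA hm hw hy hz).trans
          (Eq.trans ?_ (extensionAlong_of_map_mem_tips hq hA hm hw' hy' hz').symm)
        exact congrArg _ h

theorem exists_harmonic_extension (hq : IsSquare q) (hA : IsVicsekSet q A)
    {h : (graph q A).Pair} (hh : h.IsHarmonicStructure) (s : Fin 2) (v : Plane → ℝ) :
    ∃ u : Plane → ℝ, (∀ k, u (tips q s k) = v (tips q s k)) ∧
      ∀ n, h.level n s u = h.level 0 s v := by
  have hex : ∀ s v, ∃ u : Plane → ℝ, EqOn u v (range (tips q s)) ∧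
      h.level 1 s u = h.level 0 s v := by
    intro s v
    have := (hh.renormalization s v).1
    rwa [hA.boundary_eq hq] at this
  choose m hm hE using hex
  have key : ∀ n s v (u : Plane → ℝ), (∀ w y, (graph q A).IsWalk s w →
      y ∈ range (tips q ((graph q A).endpoint s w)) →
      u ((graph q A).map w y) = extensionAlong q A m s w v y) →
      h.level n s u = h.level 0 s v := by
    intro n
    induction n with
    | zero =>
      intro s v u hu
      rw [level_zero hq hA, level_zero hq hA]
      congr 1
      funext k
      exact hu [] _ trivial ⟨k, rfl⟩
    | succ n ih =>
      intro s v u hu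
      rw [← hE s v, GraphDirected.Pair.level, GraphDirected.Pair.level]
      refine Finset.sum_congr rfl fun e he => ?_
      have hi := (Finset.mem_filter.1 he).2
      rw [ih ((graph q A).fin e) (m s v ∘ (graph q A).ψ e) (u ∘ (graph q A).ψ e)]
      intro w y hw hy
      exact hu (e :: w) y ⟨hi, hw⟩ hy
  let ι := {a : List (Fin 6) × Plane // (graph q A).IsWalk s a.1 ∧
    a.2 ∈ range (tips q ((graph q A).endpoint s a.1))}
  let pos : ι → Plane := fun a => (graph q A).map a.1.1 a.1.2
  let val : ι → ℝ := fun a => extensionAlong q A m s a.1.1 v a.1.2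
  have hfac : val.FactorsThrough pos := fun a a' h =>
    extensionAlong_eq hq hA hm a.2.1 a'.2.1 a.2.2 a'.2.2 h
  refine ⟨Function.extend pos val 0, fun k => ?_, fun n => key n s v _ fun w y hw hy => ?_⟩
  · exact hfac.extend_apply 0 ⟨([], tips q s k), trivial, k, rfl⟩
  · exact hfac.extend_apply 0 ⟨(w, y), hw, hy⟩

end HarmonicExtension

/-! ### Symmetric harmonic structures -/

section Symmetry

variable {h : (graph q A).Pair} {a b c d : ℝ}

theorem comp_diagonalReflection_tips (hq : IsSquare q) (u : Plane → ℝ) (s : Fin 2) :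
    (u ∘ diagonalReflection q) ∘ tips q s = (u ∘ tips q s) ∘ Equiv.swap (1 : Fin 4) 3 :=
  funext fun k => congrArg u (diagonalReflection_tips hq s k)

theorem level_succ_fst (h : (graph q A).Pair) (n : ℕ) (u : Plane → ℝ) :
    h.level (n + 1) 0 u = (h.r 0)⁻¹ * h.level n 1 u + (h.r 1)⁻¹ * h.level n 0 (u ∘ F q 2) := by
  rw [GraphDirected.Pair.level, Finset.sum_filter, Fin.sum_univ_six]
  simp [graph]

theorem level_succ_snd (h : (graph q A).Pair) (n : ℕ) (u : Plane → ℝ) :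
    h.level (n + 1) 1 u = (h.r 2)⁻¹ * h.level n 1 (u ∘ F q 0) +
      (h.r 3)⁻¹ * h.level n 0 (u ∘ F q 1) + (h.r 4)⁻¹ * h.level n 0 (u ∘ F q 3) +
      (h.r 5)⁻¹ * h.level n 0 (u ∘ F q 4) := by
  rw [GraphDirected.Pair.level, Finset.sum_filter, Fin.sum_univ_six]
  simp [graph]

theorem IsSolution.level_comp_diagonalReflection (hq : IsSquare q) (hA : IsVicsekSet q A)
    (ha : 0 < a) (hb : 0 < b) (hd : 0 < d) (hs : IsSolution a b a d h) (n : ℕ) (s : Fin 2)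
    (u : Plane → ℝ) : h.level n s (u ∘ diagonalReflection q) = h.level n s u := by
  induction n generalizing s u with
  | zero =>
    rw [level_zero hq hA, level_zero hq hA, comp_diagonalReflection_tips hq]
    fin_cases s
    · change tipForm hq hA h 0 _ = tipForm hq hA h 0 _
      rw [(isStarTrace_iff hq hA h 0 (pos_star ha hb ha)).1 hs.star_one]
      conv_lhs => rw [← star_comp_swap, starForm_comp_equiv]
    · change tipForm hq hA h 1 _ = tipForm hq hA h 1 _
      rw [(isStarTrace_iff hq hA h 1 (pos_star ha hd ha)).1 hs.star_two]
      conv_lhs => rw [← star_comp_swap, starForm_comp_equiv]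
  | succ n ih =>
    have hF := diagonalReflection_F hq
    have f0 : (u ∘ diagonalReflection q) ∘ F q 0 = (u ∘ F q 0) ∘ diagonalReflection q :=
      funext fun x => congrArg u (hF x).1
    have f1 : (u ∘ diagonalReflection q) ∘ F q 1 = (u ∘ F q 3) ∘ diagonalReflection q :=
      funext fun x => congrArg u (hF x).2.1
    have f2 : (u ∘ diagonalReflection q) ∘ F q 2 = (u ∘ F q 2) ∘ diagonalReflection q :=
      funext fun x => congrArg u (hF x).2.2.1
    have f3 : (u ∘ diagonalReflection q) ∘ F q 3 = (u ∘ F q 1) ∘ diagonalReflection q :=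
      funext fun x => congrArg u (hF x).2.2.2.1
    have f4 : (u ∘ diagonalReflection q) ∘ F q 4 = (u ∘ F q 4) ∘ diagonalReflection q :=
      funext fun x => congrArg u (hF x).2.2.2.2
    have hr : h.r 3 = h.r 4 := by rw [hs.factors]; rfl
    fin_cases s
    · change h.level (n + 1) 0 _ = h.level (n + 1) 0 _
      rw [level_succ_fst, level_succ_fst, f2, ih, ih]
    · change h.level (n + 1) 1 _ = h.level (n + 1) 1 _
      rw [level_succ_snd, level_succ_snd, f0, f1, f3, f4, ih, ih, ih, ih, hr]
      ring

theorem IsSolution.isInvariantUnder_iff (hq : IsSquare q) (hA : IsVicsekSet q A)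
    (ha : 0 < a) (hb : 0 < b) (hc : 0 < c) (hd : 0 < d) (hh : h.IsHarmonicStructure)
    (hs : IsSolution a b c d h) : h.IsInvariantUnder (diagonalReflection q) ↔ a = c := by
  constructor
  · intro hinv
    have hform := (isStarTrace_iff hq hA h 0 (pos_star ha hb hc)).1 hs.star_one
    have hle : ∀ x : Fin 4 → ℝ, starForm ![1, a, b, c] (x ∘ Equiv.swap (1 : Fin 4) 3)
        ≤ starForm ![1, a, b, c] x := by
      intro x
      obtain ⟨v, rfl⟩ := exists_extend_tips hq 0 x
      obtain ⟨u, huv, hu⟩ := exists_harmonic_extension hq hA hh 0 v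
      have h1 : ENNReal.ofReal (h.level 0 0 (u ∘ diagonalReflection q))
          ≤ ENNReal.ofReal (h.level 0 0 v) := by
        calc _ ≤ h.energy 0 (u ∘ diagonalReflection q) :=
              le_iSup (fun n => ENNReal.ofReal (h.level n 0 (u ∘ diagonalReflection q))) 0
          _ = h.energy 0 u := hinv 0 u
          _ = _ := by simp only [GraphDirected.Pair.energy, hu, ciSup_const]
      have huv' : u ∘ tips q 0 = v ∘ tips q 0 := funext huv
      rw [level_zero hq hA, level_zero hq hA, comp_diagonalReflection_tips hq, hform, huv'] at h1
      refine (ENNReal.ofReal_le_ofReal_iff ?_).1 h1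
      exact Finset.sum_nonneg fun k _ => div_nonneg (sq_nonneg _) (pos_star ha hb hc k).le
    have heq : starForm ![1, a, b, c] = starForm ![1, c, b, a] := by
      funext x
      have h2 : starForm ![1, c, b, a] x
          = starForm ![1, a, b, c] (x ∘ Equiv.swap (1 : Fin 4) 3) := by
        rw [← starForm_comp_equiv ![1, c, b, a] x (Equiv.swap 1 3), star_comp_swap]
      rw [h2]
      refine le_antisymm ?_ (hle x)
      have h3 := hle (x ∘ Equiv.swap (1 : Fin 4) 3)
      have h4 : (x ∘ Equiv.swap (1 : Fin 4) 3) ∘ Equiv.swap (1 : Fin 4) 3 = x :=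
        funext fun k => congrArg x (Equiv.swap_apply_self _ _ _)
      rwa [h4] at h3
    exact congrFun (starForm_injective (pos_star ha hb hc) (pos_star hc hb ha) heq) 1
  · rintro rfl
    intro s u
    simp only [GraphDirected.Pair.energy, hs.level_comp_diagonalReflection hq hA ha hb hd]

end Symmetry

/-! ### Homogeneous harmonic structures -/

section Homogeneity

variable {h : (graph q A).Pair} {a b c d : ℝ}

open scoped Pointwise in
theorem diam_image_homothety (s : ℝ) (hs : 0 ≤ s) (p : Plane) (S : Set Plane) :
    Metric.diam ((fun x => s • x + p) '' S) = s * Metric.diam S := by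
  have h1 : (fun x => s • x + p) '' S = (fun x => x + p) '' ((fun x => s • x) '' S) := by
    rw [← image_comp]; rfl
  rw [h1, (isometry_add_right p).diam_image, show (fun x => s • x) '' S = s • S from rfl, diam_smul₀, Real.norm_of_nonneg hs]

/-- The contraction ratios of the six maps. -/
noncomputable def edgeRatio : Fin 6 → ℝ := ![1, 1 / 3, 1 / 2, 1 / 3, 1 / 3, 1 / 3]

theorem diam_image_ψ (q : Fin 4 → Plane) (A : Set Plane) (e : Fin 6) (S : Set Plane) :
    Metric.diam ((graph q A).ψ e '' S) = edgeRatio e * Metric.diam S := by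
  fin_cases e
  · change Metric.diam (id '' S) = 1 * Metric.diam S
    rw [image_id, one_mul]
  all_goals exact diam_image_homothety _ (by norm_num [edgeRatio]) _ _

theorem diam_image_map (q : Fin 4 → Plane) (A : Set Plane) (w : List (Fin 6)) (S : Set Plane) :
    Metric.diam ((graph q A).map w '' S) = (w.map edgeRatio).prod * Metric.diam S := by
  induction w with
  | nil => simp [GraphDirected.map]
  | cons e w ih =>
    rw [GraphDirected.map, image_comp, diam_image_ψ, ih, List.map_cons, List.prod_cons, mul_assoc]

theorem IsVicsekSet.diam_K_pos (hq : IsSquare q) (hA : IsVicsekSet q A) (s : Fin 2) :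
    0 < Metric.diam ((graph q A).K s) := by
  have hsub : (graph q A).K s ⊆ A := by
    fin_cases s
    exacts [subset_rfl, hA.K_one_subset]
  have hne : tips q s 0 ≠ tips q s 1 := fun h => by
    simpa using hq.tips_injective s h
  exact (dist_pos.2 hne).trans_le (Metric.dist_le_diam_of_mem
    (hA.compact.isBounded.subset hsub) (hA.tips_mem hq s 0) (hA.tips_mem hq s 1))

theorem isHomogeneous_of_factors_eq (hq : IsSquare q) (hA : IsVicsekSet q A)
    (hr : h.r = edgeRatio) : h.IsHomogeneous := by
  intro w w' _ _ he hd
  rw [GraphDirected.island, GraphDirected.island, diam_image_map, diam_image_map, he] at hd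
  rw [GraphDirected.Pair.weight, GraphDirected.Pair.weight, hr]
  exact mul_right_cancel₀ (hA.diam_K_pos hq _).ne' hd

theorem IsSolution.isHomogeneous_iff (hq : IsSquare q) (hA : IsVicsekSet q A)
    (ha : 0 < a) (hb : 0 < b) (hc : 0 < c) (hd : 0 < d)
    (hs : IsSolution a b c d h) : h.IsHomogeneous ↔ b = 1 ∧ d = 1 / 3 ∧ a = c := by
  have hr := hs.factors
  constructor
  · intro hh
    have hdiam : ∀ e : Fin 6, edgeRatio e = 1 / 3 →
        (graph q A).fin e = 0 → (graph q A).init e = 1 → h.r 1 = h.r 0 * h.r e := by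
      intro e hre hf hi
      have := hh [1] [0, e] ⟨rfl, trivial⟩ ⟨rfl, hi, trivial⟩ hf.symm (by
        have hf' : (graph q A).endpoint (graph q A).root [0, e]
            = (graph q A).endpoint (graph q A).root [1] := hf
        rw [GraphDirected.island, GraphDirected.island, diam_image_map, diam_image_map, hf']
        congr 1
        simp [edgeRatio] at hre ⊢
        exact hre.symm)
      simpa [GraphDirected.Pair.weight] using this
    have h3 := hdiam 3 rfl rfl rfl
    have h4 := hdiam 4 rfl rfl rfl
    have h5 := hdiam 5 rfl rfl rfl
    rw [hr] at h3 h4 h5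
    change (b - d) / (1 + b) = 1 * ((a * b - a * d) / (a * b + c * b)) at h3
    change (b - d) / (1 + b) = 1 * ((c * b - c * d) / (a * b + c * b)) at h4
    change (b - d) / (1 + b) = 1 * (d / b) at h5
    rw [one_mul] at h3 h4 h5
    have hbd : b - d ≠ 0 := by
      intro h0
      rw [h0, zero_div] at h5
      exact (div_pos hd hb).ne h5
    have hac : a = c := by
      have h34 := h3.symm.trans h4
      rw [div_left_inj' (by positivity)] at h34
      exact mul_right_cancel₀ hbd (by linear_combination h34)
    subst hac
    have e3 : d = b / 3 := by
      rw [h5] at h3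
      field_simp at h3
      linarith
    subst e3
    have e1 : b = 1 := by
      field_simp at h5
      linarith
    exact ⟨e1, by rw [e1], rfl⟩
  · rintro ⟨rfl, rfl, rfl⟩
    refine isHomogeneous_of_factors_eq hq hA ?_
    rw [hr]
    funext e
    fin_cases e
    · rfl
    all_goals
      simp [edgeRatio]
      try field_simp
      try norm_num

end Homogeneity

end Vicsek

theorem theorem5p6 (q : Fin 4 → Vicsek.Plane) (hq : Vicsek.IsSquare q)
    (A : Set Vicsek.Plane) (hA : Vicsek.IsVicsekSet q A) :
    -- the boundaries of the two types of islands
    (∀ s, (Vicsek.graph q A).boundary s = Set.range (Vicsek.tips q s)) ∧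
    -- all three classes are invariant under multiplying the two Laplacians by positive constants
    (∀ (h : (Vicsek.graph q A).Pair) (t : Fin 2 → ℝ), (∀ s, 0 < t s) →
      ((h.rescale t).IsRegular ↔ h.IsRegular) ∧
      ((h.rescale t).IsInvariantUnder (Vicsek.diagonalReflection q) ↔
        h.IsInvariantUnder (Vicsek.diagonalReflection q)) ∧
      ((h.rescale t).IsHomogeneous ↔ h.IsHomogeneous)) ∧
    -- every regular harmonic structure can be normalized, in exactly one way
    (∀ h : (Vicsek.graph q A).Pair, h.IsRegular →
      ∃! t : Fin 2 → ℝ, (∀ s, 0 < t s) ∧ Vicsek.IsNormalized (h.rescale t)) ∧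
    -- the normalized regular harmonic structures: four parameters
    Vicsek.Parametrizes
      {p : ℝ × ℝ × ℝ × ℝ | 0 < p.1 ∧ 0 < p.2.1 ∧ 0 < p.2.2.1 ∧ 0 < p.2.2.2 ∧ p.2.2.2 < p.2.1}
      {h : (Vicsek.graph q A).Pair | h.IsRegular ∧ Vicsek.IsNormalized h}
      (fun p h => Vicsek.IsSolution p.1 p.2.1 p.2.2.1 p.2.2.2 h) ∧
    -- the symmetric ones: three parameters `a, b, d`, with `c = a`
    Vicsek.Parametrizes
      {p : ℝ × ℝ × ℝ | 0 < p.1 ∧ 0 < p.2.1 ∧ 0 < p.2.2 ∧ p.2.2 < p.2.1}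
      {h : (Vicsek.graph q A).Pair | h.IsRegular ∧ Vicsek.IsNormalized h ∧
        h.IsInvariantUnder (Vicsek.diagonalReflection q)}
      (fun p h => Vicsek.IsSolution p.1 p.2.1 p.1 p.2.2 h) ∧
    -- the homogeneous ones: one parameter `a`, with `c = a`, `b = 1`, `d = 1/3`
    Vicsek.Parametrizes
      {a : ℝ | 0 < a}
      {h : (Vicsek.graph q A).Pair | h.IsRegular ∧ Vicsek.IsNormalized h ∧ h.IsHomogeneous}
      (fun a h => Vicsek.IsSolution a 1 a (1 / 3) h) := by
  refine ⟨hA.boundary_eq hq, fun h t ht => ⟨Vicsek.GraphDirected.Pair.isRegular_rescale_iff ht,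
    Vicsek.GraphDirected.Pair.isInvariantUnder_rescale_iff ht,
    Vicsek.GraphDirected.Pair.isHomogeneous_rescale_iff ht⟩,
    fun h hh => Vicsek.existsUnique_isNormalized_rescale hq hA hh, ⟨?_, ?_⟩, ⟨?_, ?_⟩, ⟨?_, ?_⟩⟩
  · rintro ⟨a, b, c, d⟩ ⟨ha, hb, hc, hd, hdb⟩
    have hs := Vicsek.isSolution_solutionPair hq hA ha hb hc hd
    have hreg := Vicsek.isRegular_solutionPair hq hA ha hc hd hdb
    refine ⟨_, ⟨⟨hreg, hs.isNormalized ha hb hc hd⟩, hs⟩, ?_⟩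
    rintro h ⟨⟨hh, -⟩, hs'⟩
    exact Vicsek.IsSolution.structure_unique hq hA ha hb hc hd hh.toIsHarmonicStructure
      hreg.toIsHarmonicStructure hs' hs
  · rintro h ⟨hh, hn⟩
    obtain ⟨a, b, c, d, ha, hb, hc, hd, hdb, hs⟩ := Vicsek.exists_isSolution hq hA hh hn
    refine ⟨(a, b, c, d), ⟨⟨ha, hb, hc, hd, hdb⟩, hs⟩, ?_⟩
    rintro ⟨a', b', c', d'⟩ ⟨⟨ha', hb', hc', hd', -⟩, hs'⟩
    obtain ⟨rfl, rfl, rfl, rfl⟩ := Vicsek.IsSolution.parameters_unique hq hA ha hb hc hd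
      ha' hb' hc' hd' hs hs'
    rfl
  · rintro ⟨a, b, d⟩ ⟨ha, hb, hd, hdb⟩
    have hs := Vicsek.isSolution_solutionPair hq hA ha hb ha hd
    have hreg := Vicsek.isRegular_solutionPair hq hA ha ha hd hdb
    refine ⟨_, ⟨⟨hreg, hs.isNormalized ha hb ha hd, (hs.isInvariantUnder_iff hq hA ha hb ha hd
      hreg.toIsHarmonicStructure).2 rfl⟩, hs⟩, ?_⟩
    rintro h ⟨⟨hh, -⟩, hs'⟩
    exact Vicsek.IsSolution.structure_unique hq hA ha hb ha hd hh.toIsHarmonicStructure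
      hreg.toIsHarmonicStructure hs' hs
  · rintro h ⟨hh, hn, hinv⟩
    obtain ⟨a, b, c, d, ha, hb, hc, hd, hdb, hs⟩ := Vicsek.exists_isSolution hq hA hh hn
    obtain rfl := (hs.isInvariantUnder_iff hq hA ha hb hc hd hh.toIsHarmonicStructure).1 hinv
    refine ⟨(a, b, d), ⟨⟨ha, hb, hd, hdb⟩, hs⟩, ?_⟩
    rintro ⟨a', b', d'⟩ ⟨⟨ha', hb', hd', -⟩, hs'⟩
    obtain ⟨rfl, rfl, -, rfl⟩ := Vicsek.IsSolution.parameters_unique hq hA ha hb ha hd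
      ha' hb' ha' hd' hs hs'
    rfl
  · intro a ha
    have ha : 0 < a := ha
    have hs := Vicsek.isSolution_solutionPair hq hA (d := 1 / 3) ha one_pos ha (by norm_num)
    have hreg := Vicsek.isRegular_solutionPair hq hA (b := 1) (d := 1 / 3) ha ha (by norm_num)
      (by norm_num)
    refine ⟨_, ⟨⟨hreg, hs.isNormalized ha one_pos ha (by norm_num),
      (hs.isHomogeneous_iff hq hA ha one_pos ha (by norm_num)).2 ⟨rfl, rfl, rfl⟩⟩, hs⟩, ?_⟩
    rintro h ⟨⟨hh, -⟩, hs'⟩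
    exact Vicsek.IsSolution.structure_unique hq hA ha one_pos ha (by norm_num)
      hh.toIsHarmonicStructure hreg.toIsHarmonicStructure hs' hs
  · rintro h ⟨hh, hn, hhom⟩
    obtain ⟨a, b, c, d, ha, hb, hc, hd, hdb, hs⟩ := Vicsek.exists_isSolution hq hA hh hn
    obtain ⟨rfl, rfl, rfl⟩ := (hs.isHomogeneous_iff hq hA ha hb hc hd).1 hhom
    refine ⟨a, ⟨ha, hs⟩, ?_⟩
    rintro a' ⟨ha', hs'⟩
    exact (Vicsek.IsSolution.parameters_unique hq hA ha hb ha hd ha' hb ha' hd hs hs').1.symm
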